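/- For an integer $k\ge 3$ let $P_k=\operatorname{conv}(1,\zeta_k,\dots,\zeta_k^{k-1})\subset\mathbb{C}=\mathbb{R}^2$, with $\zeta_k=e^{2\pi i/k}$, be the regular $k$-gon. For $m,n\ge 3$ let $\operatorname{Hom}(P_m,P_n)$ be the set of all affine maps $P_m\to P_n$. It is a convex polytope in the $6$-dimensional real vector space of affine maps $\mathbb{R}^2\to\mathbb{R}^2$ (each affine map $P_m\to P_n$ being identified with its unique affine extension to $\mathbb{R}^2$). The rank of $f\in\operatorname{Hom}(P_m,P_n)$ is the dimension of its image $f(P_m)$. Proposition (full-rank vertices of $\operatorname{Hom}(P_4,P_n)$). For every integer $n\ge 3$, the number of vertices of the polytope $\operatorname{Hom}(P_4,P_n)$ that have full rank, i.e. rank two, is $$\begin{cases} n^3-9n & \text{for } n \text{ odd},\\ n^3-5n^2+6n & \text{for } n \text{ even}.\end{cases}$$ -/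

import Mathlib

noncomputable section

/-- The standard regular `n`-gon: the convex hull in `ℂ = ℝ ⊕ ℝ` of
`1, ζ, ζ ^ 2, …, ζ ^ (n - 1)`, where `ζ = cos (2 * π / n) + sin (2 * π / n) * i`. -/
def regularPolygon (n : ℕ) : Set ℂ :=
  convexHull ℝ (Set.range fun k : Fin n =>
    ((Real.cos (2 * Real.pi / n) : ℂ) + (Real.sin (2 * Real.pi / n) : ℂ) * Complex.I) ^ (k : ℕ))

/-- The hom-polytope `Hom(P, Q)` of two polygons in the plane, as a subset of the real vector
space of affine maps of the plane.  For `P` with affine hull the whole plane (the only case in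
which it is used), an affine map `P → Q` is the restriction of exactly one affine map of the
plane sending `P` into `Q`, so this is the set of all affine maps `P → Q`. -/
def homPolytope (P Q : Set ℂ) : Set (ℂ →ᵃ[ℝ] ℂ) :=
  {f | Set.MapsTo f P Q}

/-- The rank of an affine map on `P`: the dimension of (the affine hull of) the image of `P`. -/
def mapRank (P : Set ℂ) (f : ℂ →ᵃ[ℝ] ℂ) : ℕ :=
  Module.finrank ℝ (vectorSpan ℝ (f '' P))

/-- The vertices (extreme points) of `Hom(P, Q)` of rank `r`. -/
def verticesOfRank (P Q : Set ℂ) (r : ℕ) : Set (ℂ →ᵃ[ℝ] ℂ) :=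
  {f | f ∈ (homPolytope P Q).extremePoints ℝ ∧ mapRank P f = r}

end

/-! An affine map on the square is determined by the images `x 0, x 1, x 2, x 3` of its vertices,
and a quadruple of points arises in this way exactly when `x 0 + x 2 = x 1 + x 3`. So the polytope
is the space of possibly degenerate parallelograms inside the `n`-gon, and rank two means that the
diagonals are linearly independent.

Such a parallelogram is extreme iff it admits no small motion inside the polygon in both directions.
A polygon vertex cannot move, a point of an open edge moves only along that edge, and an interior
point moves freely. Hence extremality holds exactly when at least three corners are polygon
vertices, or two are vertices and the other two lie on non-parallel open edges (`IsRigid`, proved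
equivalent in `isRigid_of_mem_extremePoints` and `mem_extremePoints_of_isRigid`).

The nondegenerate rigid parallelograms are counted by the set of corners that are vertices, up to
cyclic shift. Four vertices: a parallelogram inscribed in a circle is a rectangle, so `n` is even,
and there are `n (n - 2)` of them. Exactly three: the fourth corner has squared norm `1 + 8 sin sin
cos` of the relevant angles (`normSq_fourth`), so it lies in the polygon without being a vertex iff
the angle at the middle vertex is obtuse. With `M = n - 1 - ⌊n/2⌋` this gives `n M (M - 1)` for each
of the four positions. Two opposite vertices: impossible (`opposite_false`). Two adjacent vertices:
the opposite side must be placed symmetrically about the bisector of the given chord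
(`adjacent_symm`). For even `n` this is impossible. For odd `n` each admissible chord has exactly
one such translate (`adjacent_odd`, `chordEnd_openEdge`), which gives `n (n - 3)` for each of the
four positions.

The totals are `n (n - 1) (n - 3) + 4 n (n - 3) = n³ - 9 n` for odd `n` and `n (n - 2) + n (n - 2)
(n - 4) = n³ - 5 n² + 6 n` for even `n`. -/

noncomputable section

open Complex

/-- The point of the unit circle with argument `s * π / n`. -/
def cis (n : ℕ) (s : ℤ) : ℂ :=
  ⟨Real.cos (s * (Real.pi / n)), Real.sin (s * (Real.pi / n))⟩

/-- The inner product of `z` with `cis n s`. -/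
def proj (n : ℕ) (s : ℤ) (z : ℂ) : ℝ :=
  z.re * Real.cos (s * (Real.pi / n)) + z.im * Real.sin (s * (Real.pi / n))

/-- The relatively open edge of the regular polygon with outer normal `cis n (2 * t + 1)`. -/
def OpenEdge (n : ℕ) (t : ℤ) (z : ℂ) : Prop :=
  ∃ a b : ℝ, 0 < a ∧ 0 < b ∧ a + b = 1 ∧ z = a • cis n (2 * t) + b • cis n (2 * t + 2)

/-- The set of vertices of the regular polygon. -/
def polygonVertices (n : ℕ) : Set ℂ := {z | ∃ k : ℤ, z = cis n (2 * k)}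

/-! ### Trigonometry at integer multiples of `π / n` -/

section cis

variable {n : ℕ}

@[simp] lemma cis_re (s : ℤ) : (cis n s).re = Real.cos (s * (Real.pi / n)) := rfl
@[simp] lemma cis_im (s : ℤ) : (cis n s).im = Real.sin (s * (Real.pi / n)) := rfl

lemma cis_add (s t : ℤ) : cis n (s + t) = cis n s * cis n t := by
  apply Complex.ext
  · simp [add_mul, Real.cos_add]
  · simp [add_mul, Real.sin_add]; ring

@[simp] lemma cis_zero : cis n 0 = 1 := by
  apply Complex.ext <;> simp

lemma cis_self (hn : n ≠ 0) : cis n n = -1 := by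
  have h : ((n : ℤ) : ℝ) * (Real.pi / n) = Real.pi := by
    have : (n : ℝ) ≠ 0 := by exact_mod_cast hn
    push_cast; field_simp
  apply Complex.ext <;> simp only [cis_re, cis_im, h] <;> simp

lemma cis_add_self (hn : n ≠ 0) (s : ℤ) : cis n (s + n) = -cis n s := by
  rw [cis_add, cis_self hn]; ring

lemma cis_add_two_mul (hn : n ≠ 0) (s k : ℤ) : cis n (s + 2 * n * k) = cis n s := by
  have h : ((s + 2 * n * k : ℤ) : ℝ) * (Real.pi / n) = s * (Real.pi / n) + k * (2 * Real.pi) := by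
    have : (n : ℝ) ≠ 0 := by exact_mod_cast hn
    push_cast; field_simp
  apply Complex.ext
  · simp only [cis_re, h, Real.cos_add_int_mul_two_pi]
  · simp only [cis_im, h, Real.sin_add_int_mul_two_pi]

lemma cis_pow (s : ℤ) (k : ℕ) : cis n s ^ k = cis n (k * s) := by
  induction k with
  | zero => simp
  | succ k ih => rw [pow_succ, ih, ← cis_add]; congr 1; push_cast; ring

lemma cis_sq_add_sq (s : ℤ) : Real.cos (s * (Real.pi / n)) ^ 2 +
    Real.sin (s * (Real.pi / n)) ^ 2 = 1 := Real.cos_sq_add_sin_sq _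

lemma proj_add (s : ℤ) (z w : ℂ) : proj n s (z + w) = proj n s z + proj n s w := by
  simp [proj]; ring

lemma proj_sub (s : ℤ) (z w : ℂ) : proj n s (z - w) = proj n s z - proj n s w := by
  simp [proj]; ring

lemma proj_neg (s : ℤ) (z : ℂ) : proj n s (-z) = -proj n s z := by
  simp [proj]; ring

lemma proj_smul (s : ℤ) (a : ℝ) (z : ℂ) : proj n s (a • z) = a * proj n s z := by
  simp [proj]; ring

lemma proj_cis (s t : ℤ) : proj n s (cis n t) = Real.cos ((t - s : ℤ) * (Real.pi / n)) := by
  simp [proj, sub_mul, Real.cos_sub]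

lemma proj_add_self (hn : n ≠ 0) (s : ℤ) (z : ℂ) : proj n (s + n) z = -proj n s z := by
  have h := cis_add_self hn s
  have h1 := congrArg Complex.re h
  have h2 := congrArg Complex.im h
  simp only [cis_re, cis_im, neg_re, neg_im] at h1 h2
  simp only [proj, h1, h2]; ring

/-- Reduction of an integer multiple of `π / n` to the interval `[0, π]`. -/
lemma exists_reduced (hn : n ≠ 0) (m : ℤ) : ∃ r : ℤ, 0 ≤ r ∧ r ≤ n ∧
    Real.cos (m * (Real.pi / n)) = Real.cos (r * (Real.pi / n)) ∧
    ((2 * n : ℤ) ∣ m - r ∨ (2 * n : ℤ) ∣ m + r) := by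
  have hn' : (0 : ℤ) < 2 * n := by positivity
  have h0 := Int.emod_nonneg m hn'.ne'
  have h1 := Int.emod_lt_of_pos m hn'
  have h2 := Int.emod_add_mul_ediv m (2 * n)
  set r := m % (2 * n) with hr
  have hc : Real.cos (m * (Real.pi / n)) = Real.cos (r * (Real.pi / n)) := by
    have := congrArg Complex.re (cis_add_two_mul hn r (m / (2 * n)))
    rw [h2] at this
    simpa using this
  by_cases h : r ≤ n
  · exact ⟨r, h0, h, hc, Or.inl ⟨m / (2 * n), by linarith⟩⟩
  · refine ⟨2 * n - r, by linarith, by linarith, ?_, Or.inr ⟨m / (2 * n) + 1, by linarith⟩⟩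
    rw [hc]
    have := congrArg Complex.re (cis_add_two_mul hn (-r) 1)
    simp only [cis_re] at this
    rw [show (2 * n - r : ℤ) = -r + 2 * n * 1 by ring, this]
    push_cast
    rw [neg_mul, Real.cos_neg]

lemma cos_reduced_le (hn : n ≠ 0) {r s : ℤ} (hr : 0 ≤ r) (hrs : r ≤ s) (hs : s ≤ n) :
    Real.cos (s * (Real.pi / n)) ≤ Real.cos (r * (Real.pi / n)) := by
  have hn' : (0 : ℝ) < n := by positivity
  have hp : 0 ≤ Real.pi / n := by positivity
  have hr' : (0 : ℝ) ≤ r := by exact_mod_cast hr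
  have hrs' : (r : ℝ) ≤ s := by exact_mod_cast hrs
  have hs' : (s : ℝ) ≤ n := by exact_mod_cast hs
  apply Real.cos_le_cos_of_nonneg_of_le_pi
  · positivity
  · calc (s : ℝ) * (Real.pi / n) ≤ n * (Real.pi / n) := by gcongr
      _ = Real.pi := by field_simp
  · gcongr

lemma cos_reduced_lt (hn : n ≠ 0) {r s : ℤ} (hr : 0 ≤ r) (hrs : r < s) (hs : s ≤ n) :
    Real.cos (s * (Real.pi / n)) < Real.cos (r * (Real.pi / n)) := by
  have hn' : (0 : ℝ) < n := by positivity
  have hp : 0 < Real.pi / n := by positivity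
  have hr' : (0 : ℝ) ≤ r := by exact_mod_cast hr
  have hrs' : (r : ℝ) < s := by exact_mod_cast hrs
  have hs' : (s : ℝ) ≤ n := by exact_mod_cast hs
  apply Real.cos_lt_cos_of_nonneg_of_le_pi
  · positivity
  · calc (s : ℝ) * (Real.pi / n) ≤ n * (Real.pi / n) := by gcongr
      _ = Real.pi := by field_simp
  · gcongr

lemma cos_eq_one_iff_dvd (hn : n ≠ 0) (m : ℤ) :
    Real.cos (m * (Real.pi / n)) = 1 ↔ (2 * n : ℤ) ∣ m := by
  obtain ⟨r, h0, h1, hc, hd⟩ := exists_reduced hn m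
  constructor
  · intro h
    have : r = 0 := by
      by_contra hne
      have := cos_reduced_lt hn le_rfl (lt_of_le_of_ne h0 (Ne.symm hne)) h1
      rw [← hc, h] at this
      simp at this
    subst this
    simpa using hd
  · rintro ⟨k, rfl⟩
    have := congrArg Complex.re (cis_add_two_mul hn 0 k)
    simpa using this

lemma cis_eq_iff (hn : n ≠ 0) (s t : ℤ) : cis n s = cis n t ↔ (2 * n : ℤ) ∣ s - t := by
  constructor
  · intro h
    rw [← cos_eq_one_iff_dvd hn, ← proj_cis, h, proj_cis]
    simp
  · rintro ⟨k, hk⟩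
    rw [show s = t + 2 * n * k by linarith, cis_add_two_mul hn]

/-- The period `2 * n` is even, so an odd multiple of `π / n` never reduces to `0`, and its
reduction is at least `1`. This is the edge inequality at the vertices; `odd_cos_eq` identifies the
two vertices where it is tight. -/
lemma odd_cos_le (hn : n ≠ 0) (m : ℤ) :
    Real.cos ((2 * m + 1 : ℤ) * (Real.pi / n)) ≤ Real.cos (Real.pi / n) := by
  obtain ⟨r, h0, h1, hc, hd⟩ := exists_reduced hn (2 * m + 1)
  have h : 1 ≤ r := by
    rcases hd with ⟨k, hk⟩ | ⟨k, hk⟩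
    · have : r ≠ 0 := by
        rintro rfl
        have : 2 * (n * k) = 2 * m + 1 := by linarith
        omega
      omega
    · have : r ≠ 0 := by
        rintro rfl
        have : 2 * (n * k) = 2 * m + 1 := by linarith
        omega
      omega
  rw [hc]
  simpa using cos_reduced_le hn zero_le_one h h1

lemma odd_cos_eq (hn : n ≠ 0) (m : ℤ)
    (h : Real.cos ((2 * m + 1 : ℤ) * (Real.pi / n)) = Real.cos (Real.pi / n)) :
    (n : ℤ) ∣ m ∨ (n : ℤ) ∣ m + 1 := by
  obtain ⟨r, h0, h1, hc, hd⟩ := exists_reduced hn (2 * m + 1)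
  have hr : r ≤ 1 := by
    by_contra hlt
    have := cos_reduced_lt hn zero_le_one (not_le.mp hlt) h1
    rw [← hc, h] at this
    simp at this
  rcases hd with ⟨k, hk⟩ | ⟨k, hk⟩
  · left
    refine ⟨k, ?_⟩
    have : 2 * (n * k) = 2 * m + 1 - r := by linarith
    omega
  · right
    refine ⟨k, ?_⟩
    have : 2 * (n * k) = 2 * m + 1 + r := by linarith
    omega

end cis

/-! ### Edges, vertices and inequalities of the regular polygon -/

section polygon

variable {n : ℕ}

lemma pi_div_pos (hn : 3 ≤ n) : 0 < Real.pi / n := by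
  have : 0 < n := by omega
  positivity

lemma pi_div_le (hn : 3 ≤ n) : Real.pi / n ≤ Real.pi / 3 := by
  have : (3 : ℝ) ≤ n := by exact_mod_cast hn
  have := Real.pi_pos
  gcongr

lemma cos_pi_div_pos (hn : 3 ≤ n) : 0 < Real.cos (Real.pi / n) := by
  apply Real.cos_pos_of_mem_Ioo
  have := pi_div_pos hn
  have := pi_div_le hn
  have := Real.pi_pos
  constructor <;> linarith

lemma sin_pi_div_pos (hn : 3 ≤ n) : 0 < Real.sin (Real.pi / n) := by
  apply Real.sin_pos_of_pos_of_lt_pi (pi_div_pos hn)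
  have := pi_div_le hn
  have := Real.pi_pos
  linarith

lemma cos_pi_div_lt_one (hn : 3 ≤ n) : Real.cos (Real.pi / n) < 1 := by
  nlinarith [sin_pi_div_pos hn, Real.cos_sq_add_sin_sq (Real.pi / n), cos_pi_div_pos hn]

lemma regularPolygon_eq (n : ℕ) :
    regularPolygon n = convexHull ℝ (Set.range fun k : Fin n => cis n (2 * (k : ℤ))) := by
  unfold regularPolygon
  congr 2
  funext k
  have : ((Real.cos (2 * Real.pi / n) : ℂ) + (Real.sin (2 * Real.pi / n) : ℂ) * Complex.I)
      = cis n 2 := by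
    apply Complex.ext <;> simp only [add_re, add_im, mul_re, mul_im, ofReal_re, ofReal_im,
      I_re, I_im, cis_re, cis_im] <;> push_cast <;> ring_nf
  rw [this, cis_pow]
  congr 1
  ring

lemma cis_mem (hn : 3 ≤ n) (k : ℤ) : cis n (2 * k) ∈ regularPolygon n := by
  rw [regularPolygon_eq]
  apply subset_convexHull
  have hn' : (0 : ℤ) < n := by omega
  have h0 := Int.emod_nonneg k hn'.ne'
  have h1 := Int.emod_lt_of_pos k hn'
  refine ⟨⟨(k % n).toNat, by omega⟩, ?_⟩
  simp only [Int.toNat_of_nonneg h0]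
  rw [cis_eq_iff (by omega)]
  have := Int.emod_add_mul_ediv k n
  exact ⟨-(k / n), by linarith⟩

lemma polygonVertices_subset (hn : 3 ≤ n) : polygonVertices n ⊆ regularPolygon n := by
  rintro _ ⟨k, rfl⟩
  exact cis_mem hn k

lemma convex_regularPolygon (n : ℕ) : Convex ℝ (regularPolygon n) := convex_convexHull _ _

lemma proj_vertex_le (hn : 3 ≤ n) (t k : ℤ) :
    proj n (2 * t + 1) (cis n (2 * k)) ≤ Real.cos (Real.pi / n) := by
  rw [proj_cis, show 2 * k - (2 * t + 1) = 2 * (k - t - 1) + 1 by ring]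
  exact odd_cos_le (by omega) _

lemma proj_le (hn : 3 ≤ n) (t : ℤ) {z : ℂ} (hz : z ∈ regularPolygon n) :
    proj n (2 * t + 1) z ≤ Real.cos (Real.pi / n) := by
  have : regularPolygon n ⊆ {z | proj n (2 * t + 1) z ≤ Real.cos (Real.pi / n)} := by
    rw [regularPolygon_eq]
    apply convexHull_min
    · rintro _ ⟨k, rfl⟩
      exact proj_vertex_le hn t _
    · intro x hx y hy a b ha hb hab
      rw [Set.mem_ofPred_eq] at *
      rw [proj_add, proj_smul, proj_smul]
      calc _ ≤ a * Real.cos (Real.pi / n) + b * Real.cos (Real.pi / n) := by gcongr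
        _ = _ := by rw [← add_mul, hab, one_mul]
  exact this hz

lemma exists_sector (hn : 3 ≤ n) (z : ℂ) : ∃ (t : ℤ) (a b : ℝ), 0 ≤ a ∧ 0 ≤ b ∧
    z = a • cis n (2 * t) + b • cis n (2 * t + 2) := by
  set θ := Real.pi / n with hθ
  have hpos : 0 < θ := pi_div_pos hn
  have hle : θ ≤ Real.pi / 3 := pi_div_le hn
  have hs : 0 < Real.sin (2 * θ) := by
    apply Real.sin_pos_of_pos_of_lt_pi <;> linarith [Real.pi_pos]
  set t := ⌊Complex.arg z / (2 * θ)⌋ with ht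
  have h1 : (t : ℝ) * (2 * θ) ≤ Complex.arg z := by
    have := Int.floor_le (Complex.arg z / (2 * θ))
    rwa [le_div_iff₀ (by positivity)] at this
  have h2 : Complex.arg z < ((t : ℝ) + 1) * (2 * θ) := by
    have := Int.lt_floor_add_one (Complex.arg z / (2 * θ))
    rwa [div_lt_iff₀ (by positivity)] at this
  obtain ⟨φ, hφ⟩ : ∃ φ, φ = Complex.arg z - t * (2 * θ) := ⟨_, rfl⟩
  have hz : z = ⟨‖z‖ * Real.cos (t * (2 * θ) + φ), ‖z‖ * Real.sin (t * (2 * θ) + φ)⟩ := by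
    rw [show (t : ℝ) * (2 * θ) + φ = Complex.arg z by rw [hφ]; ring]
    apply Complex.ext <;> simp [Complex.norm_mul_cos_arg, Complex.norm_mul_sin_arg]
  -- By the sine rule: `φ` is the angle from the first ray of the sector to `z`, and `2 * θ` is the
  -- opening angle.
  refine ⟨t, ‖z‖ * Real.sin (2 * θ - φ) / Real.sin (2 * θ), ‖z‖ * Real.sin φ / Real.sin (2 * θ),
    ?_, ?_, ?_⟩
  · have : 0 ≤ Real.sin (2 * θ - φ) := by
      apply Real.sin_nonneg_of_nonneg_of_le_pi <;> linarith [Real.pi_pos]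
    positivity
  · have : 0 ≤ Real.sin φ := by
      apply Real.sin_nonneg_of_nonneg_of_le_pi <;> linarith [Real.pi_pos]
    positivity
  · rw [hz]
    have e1 : ((2 * t : ℤ) : ℝ) * (Real.pi / n) = t * (2 * θ) := by push_cast; ring
    have e2 : ((2 * t + 2 : ℤ) : ℝ) * (Real.pi / n) = t * (2 * θ) + 2 * θ := by push_cast; ring
    have hnorm : ‖(⟨‖z‖ * Real.cos (t * (2 * θ) + φ), ‖z‖ * Real.sin (t * (2 * θ) + φ)⟩ : ℂ)‖
        = ‖z‖ := by rw [← hz]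
    have hsc := Real.sin_sq_add_cos_sq (2 * θ)
    apply Complex.ext
    · simp only [add_re, smul_re, smul_eq_mul, cis_re, e1, e2, hnorm]
      rw [Real.cos_add, Real.cos_add, Real.sin_sub]
      field_simp
      ring
    · simp only [add_im, smul_im, smul_eq_mul, cis_im, e1, e2, hnorm]
      rw [Real.sin_add, Real.sin_add, Real.sin_sub]
      field_simp
      ring

lemma proj_edge (t : ℤ) (a b : ℝ) :
    proj n (2 * t + 1) (a • cis n (2 * t) + b • cis n (2 * t + 2))
      = (a + b) * Real.cos (Real.pi / n) := by
  rw [proj_add, proj_smul, proj_smul, proj_cis, proj_cis]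
  rw [show 2 * t - (2 * t + 1) = -1 by ring, show 2 * t + 2 - (2 * t + 1) = 1 by ring]
  simp only [Int.cast_neg, Int.cast_one, neg_mul, one_mul, Real.cos_neg]
  ring

/-- The vertex `1` cancels against the expression of `-1` in its sector; normalizing the
coefficients gives a convex combination equal to `0`. -/
lemma zero_mem_regularPolygon (hn : 3 ≤ n) : (0 : ℂ) ∈ regularPolygon n := by
  obtain ⟨t, a, b, ha, hb, h⟩ := exists_sector hn (-1 : ℂ)
  have hpos : 0 < 1 + a + b := by positivity
  have h0 : (0 : ℂ) = (1 / (1 + a + b)) • cis n (2 * 0) + (a / (1 + a + b)) • cis n (2 * t)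
      + (b / (1 + a + b)) • cis n (2 * (t + 1)) := by
    have : (1 : ℂ) + (a • cis n (2 * t) + b • cis n (2 * t + 2)) = 0 := by rw [← h]; ring
    calc (0 : ℂ) = (1 / (1 + a + b)) • (1 + (a • cis n (2 * t) + b • cis n (2 * t + 2))) := by
          rw [this, smul_zero]
      _ = _ := by
        rw [mul_zero, cis_zero, show 2 * (t + 1) = 2 * t + 2 by ring]
        module
  rw [h0]
  have hsum : ∑ i : Fin 3, ![1 / (1 + a + b), a / (1 + a + b), b / (1 + a + b)] i = 1 := by
    simp [Fin.sum_univ_three]; field_simp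
  have := (convex_regularPolygon n).sum_mem (t := Finset.univ)
    (w := ![1 / (1 + a + b), a / (1 + a + b), b / (1 + a + b)])
    (z := ![cis n (2 * 0), cis n (2 * t), cis n (2 * (t + 1))])
    (by intro i _; fin_cases i <;> simp <;> positivity) hsum
    (by intro i _; fin_cases i <;> simp only [Fin.zero_eta, Fin.mk_one, Fin.reduceFinMk,
          Matrix.cons_val] <;> exact cis_mem hn _)
  simpa [Fin.sum_univ_three] using this

lemma sector_mem (hn : 3 ≤ n) (t : ℤ) {a b : ℝ} (ha : 0 ≤ a) (hb : 0 ≤ b) (hab : a + b ≤ 1) :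
    a • cis n (2 * t) + b • cis n (2 * t + 2) ∈ regularPolygon n := by
  have h2 := cis_mem hn (t + 1)
  rw [mul_add, mul_one] at h2
  by_cases h : a + b = 0
  · have h1 : a = 0 := by linarith
    have h2 : b = 0 := by linarith
    simpa [h1, h2] using zero_mem_regularPolygon hn
  · have hpos : 0 < a + b := lt_of_le_of_ne (by positivity) (Ne.symm h)
    have := (convex_regularPolygon n) (cis_mem hn t) h2 (a := a / (a + b)) (b := b / (a + b))
      (by positivity) (by positivity) (by field_simp)
    have := (convex_regularPolygon n) (zero_mem_regularPolygon hn) this (a := 1 - (a + b))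
      (b := a + b) (by linarith) hpos.le (by ring)
    convert this using 1
    rw [smul_zero, zero_add, smul_add, smul_smul, smul_smul]
    congr 2 <;> field_simp

/-- For a point in the sector of an edge, the inequality of that one edge already bounds the sum of
the sector coordinates by `1`. -/
lemma mem_regularPolygon_iff (hn : 3 ≤ n) (z : ℂ) :
    z ∈ regularPolygon n ↔ ∀ t : ℤ, proj n (2 * t + 1) z ≤ Real.cos (Real.pi / n) := by
  refine ⟨fun hz t => proj_le hn t hz, fun h => ?_⟩
  obtain ⟨t, a, b, ha, hb, rfl⟩ := exists_sector hn z
  apply sector_mem hn t ha hb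
  have := h t
  rw [proj_edge] at this
  have := cos_pi_div_pos hn
  by_contra hlt
  nlinarith

/-- A point of the regular polygon is a vertex, lies on a relatively open edge, or satisfies
all the edge inequalities strictly with a uniform gap. -/
lemma regularPolygon_trichotomy (hn : 3 ≤ n) {z : ℂ} (hz : z ∈ regularPolygon n) :
    z ∈ polygonVertices n ∨ (∃ t, OpenEdge n t z) ∨
      ∃ ε > 0, ∀ t : ℤ, proj n (2 * t + 1) z + ε ≤ Real.cos (Real.pi / n) := by
  obtain ⟨t, a, b, ha, hb, h⟩ := exists_sector hn z
  have hc := cos_pi_div_pos hn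
  have hab : a + b ≤ 1 := by
    have := proj_le hn t hz
    rw [h, proj_edge] at this
    by_contra hlt
    nlinarith
  rcases hab.lt_or_eq with hlt | heq
  · right; right
    -- Both sector vertices satisfy every edge inequality, so each projection of `z` is at most `(a
    -- + b) * cos (π / n)`.
    refine ⟨(1 - (a + b)) * Real.cos (Real.pi / n), mul_pos (by linarith) hc, fun s => ?_⟩
    have h1 := proj_vertex_le hn s t
    have h2 := proj_vertex_le hn s (t + 1)
    rw [mul_add, mul_one] at h2
    rw [h, proj_add, proj_smul, proj_smul]
    nlinarith
  · rcases ha.eq_or_lt with rfl | ha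
    · left
      refine ⟨t + 1, ?_⟩
      rw [h, show b = 1 by linarith, mul_add]; simp
    · rcases hb.eq_or_lt with rfl | hb
      · left
        refine ⟨t, ?_⟩
        rw [h, show a = 1 by linarith]; simp
      · right; left
        exact ⟨t, a, b, ha, hb, heq, h⟩

lemma OpenEdge.mem (hn : 3 ≤ n) {t : ℤ} {z : ℂ} (h : OpenEdge n t z) : z ∈ regularPolygon n := by
  obtain ⟨a, b, ha, hb, hab, rfl⟩ := h
  exact sector_mem hn t ha.le hb.le hab.le

lemma OpenEdge.proj_eq {t : ℤ} {z : ℂ} (h : OpenEdge n t z) :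
    proj n (2 * t + 1) z = Real.cos (Real.pi / n) := by
  obtain ⟨a, b, ha, hb, hab, rfl⟩ := h
  rw [proj_edge, hab, one_mul]

/-- Strict convexity of the disc: the squared norm is `1 - 2ab(1 - cos (2π/n))`. -/
lemma OpenEdge.normSq_lt (hn : 3 ≤ n) {t : ℤ} {z : ℂ} (h : OpenEdge n t z) :
    z.re ^ 2 + z.im ^ 2 < 1 := by
  obtain ⟨a, b, ha, hb, hab, rfl⟩ := h
  have h1 := cis_sq_add_sq (n := n) (2 * t)
  have h2 := cis_sq_add_sq (n := n) (2 * t + 2)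
  have h3 := proj_cis (n := n) (2 * t) (2 * t + 2)
  have h4 : Real.cos ((2 * t + 2 - 2 * t : ℤ) * (Real.pi / n)) < 1 := by
    refine lt_of_le_of_ne (Real.cos_le_one _) fun h => ?_
    rw [cos_eq_one_iff_dvd (by omega)] at h
    have := Int.le_of_dvd (by omega) h
    omega
  rw [← h3] at h4
  simp only [proj, cis_re, cis_im] at h4
  simp only [add_re, add_im, smul_re, smul_im, cis_re, cis_im, smul_eq_mul]
  have hb' : b = 1 - a := by linarith
  subst hb'
  have := mul_pos ha hb
  nlinarith

lemma normSq_vertex {z : ℂ} (h : z ∈ polygonVertices n) : z.re ^ 2 + z.im ^ 2 = 1 := by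
  obtain ⟨k, rfl⟩ := h
  exact cis_sq_add_sq _

lemma OpenEdge.notMem (hn : 3 ≤ n) {t : ℤ} {z : ℂ} (h : OpenEdge n t z) :
    z ∉ polygonVertices n := fun h' => by
  have := h.normSq_lt hn
  have := normSq_vertex h'
  linarith

/-- A point of an open edge lies on the supporting line of no other edge. -/
lemma OpenEdge.dvd_of_proj_eq (hn : 3 ≤ n) {s t : ℤ} {z : ℂ} (hs : OpenEdge n s z)
    (h : proj n (2 * t + 1) z = Real.cos (Real.pi / n)) : (n : ℤ) ∣ s - t := by
  obtain ⟨a, b, ha, hb, hab, rfl⟩ := hs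
  have hb' : b = 1 - a := by linarith
  subst hb'
  have h1 := proj_vertex_le hn t s
  have h2 := proj_vertex_le hn t (s + 1)
  have e : 2 * (s + 1) = 2 * s + 2 := by ring
  rw [proj_add, proj_smul, proj_smul, ← e] at h
  have h1' : proj n (2 * t + 1) (cis n (2 * s)) = Real.cos (Real.pi / n) := by nlinarith
  have h2' : proj n (2 * t + 1) (cis n (2 * (s + 1))) = Real.cos (Real.pi / n) := by nlinarith
  rw [proj_cis, show 2 * s - (2 * t + 1) = 2 * (s - t - 1) + 1 by ring] at h1'
  rw [proj_cis, show 2 * (s + 1) - (2 * t + 1) = 2 * (s - t) + 1 by ring] at h2'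
  -- Both ends of the edge `s` lie on the line of edge `t`. If this did not force `s ≡ t`, then `s -
  -- t` would be both `1` and `-1` modulo `n`, whence `n ∣ 2`.
  rcases odd_cos_eq (by omega) _ h1' with ⟨k, hk⟩ | h3
  · rcases odd_cos_eq (by omega) _ h2' with h4 | ⟨l, hl⟩
    · exact h4
    · exfalso
      have : (n : ℤ) ∣ 2 := ⟨l - k, by linarith⟩
      have := Int.le_of_dvd (by omega) this
      omega
  · simpa using h3

lemma normSq_le {z : ℂ} (hz : z ∈ regularPolygon n) : z.re ^ 2 + z.im ^ 2 ≤ 1 := by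
  have : regularPolygon n ⊆ Metric.closedBall 0 1 := by
    rw [regularPolygon_eq]
    apply convexHull_min _ (convex_closedBall _ _)
    rintro _ ⟨k, rfl⟩
    rw [mem_closedBall_zero_iff, ← sq_le_one_iff₀ (norm_nonneg _), ← Complex.normSq_eq_norm_sq,
      Complex.normSq_apply]
    have := cis_sq_add_sq (n := n) (2 * (k : ℤ))
    simp only [cis_re, cis_im]
    nlinarith
  have := this hz
  rw [mem_closedBall_zero_iff, ← sq_le_one_iff₀ (norm_nonneg _), ← Complex.normSq_eq_norm_sq,
      Complex.normSq_apply] at this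
  nlinarith

/-- A point of the unit disc on the line through two consecutive vertices, not itself a boundary
point of the disc, lies on the open edge. -/
lemma openEdge_of_normSq_lt (hn : 3 ≤ n) {t : ℤ} {z : ℂ}
    (h : proj n (2 * t + 1) z = Real.cos (Real.pi / n)) (hz : z.re ^ 2 + z.im ^ 2 < 1) :
    OpenEdge n t z := by
  obtain ⟨ψ, hψ⟩ : ∃ ψ : ℝ, ψ = (2 * t + 1 : ℤ) * (Real.pi / n) := ⟨_, rfl⟩
  have hs := sin_pi_div_pos hn
  have hsc := Real.sin_sq_add_cos_sq (Real.pi / n)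
  have hψ1 := Real.sin_sq_add_cos_sq ψ
  have e1 : ((2 * t : ℤ) : ℝ) * (Real.pi / n) = ψ - Real.pi / n := by rw [hψ]; push_cast; ring
  have e2 : ((2 * t + 2 : ℤ) : ℝ) * (Real.pi / n) = ψ + Real.pi / n := by
    rw [hψ]; push_cast; ring
  rw [proj, ← hψ] at h
  -- `y` is the coordinate along the edge, measured from its midpoint in units of half the edge
  -- length.
  obtain ⟨y, hy⟩ : ∃ y, y = (z.im * Real.cos ψ - z.re * Real.sin ψ) / Real.sin (Real.pi / n) :=
    ⟨_, rfl⟩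
  have hy' : y * Real.sin (Real.pi / n) = z.im * Real.cos ψ - z.re * Real.sin ψ := by
    rw [hy]; field_simp
  have hsq : y ^ 2 * Real.sin (Real.pi / n) ^ 2 < Real.sin (Real.pi / n) ^ 2 := by
    have : (z.im * Real.cos ψ - z.re * Real.sin ψ) ^ 2 + (z.re * Real.cos ψ + z.im * Real.sin ψ) ^ 2
        = z.re ^ 2 + z.im ^ 2 := by
      linear_combination (z.re ^ 2 + z.im ^ 2) * hψ1
    rw [← hy', h] at this
    nlinarith
  have hy1 : y ^ 2 < 1 := by
    by_contra hlt
    have : 0 < Real.sin (Real.pi / n) ^ 2 := by positivity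
    nlinarith
  obtain ⟨hl, hr⟩ := abs_lt.mp ((sq_lt_one_iff_abs_lt_one y).mp hy1)
  refine ⟨(1 - y) / 2, (1 + y) / 2, by linarith, by linarith, by ring, ?_⟩
  apply Complex.ext
  · simp only [add_re, smul_re, smul_eq_mul, cis_re, e1, e2, Real.cos_sub, Real.cos_add]
    linear_combination (-z.re) * hψ1 + Real.cos ψ * h + Real.sin ψ * hy'
  · simp only [add_im, smul_im, smul_eq_mul, cis_im, e1, e2, Real.sin_sub, Real.sin_add]
    linear_combination (-z.im) * hψ1 + Real.sin ψ * h - Real.cos ψ * hy'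

end polygon

end

/-! ### Affine maps on the square as parallelograms -/

noncomputable section

open Complex

/-- The images of the vertices `1, I, -1, -I` of the square under an affine map. -/
def squareTuple (f : ℂ →ᵃ[ℝ] ℂ) : Fin 4 → ℂ := fun i => f (I ^ (i : ℕ))

/-- The determinant of two complex numbers regarded as vectors of the plane. -/
def planeDet (z w : ℂ) : ℝ := z.re * w.im - z.im * w.re

/-- The affine map of the plane sending `0`, `1` and `I` to `c`, `c + u` and `c + v`. -/
def affineOfFrame (c u v : ℂ) : ℂ →ᵃ[ℝ] ℂ :=
  (reLm.smulRight u + imLm.smulRight v).toAffineMap + AffineMap.const ℝ ℂ c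

lemma affineOfFrame_apply (c u v z : ℂ) :
    affineOfFrame c u v z = z.re • u + z.im • v + c := by
  simp [affineOfFrame]

lemma eq_affineOfFrame (f : ℂ →ᵃ[ℝ] ℂ) :
    f = affineOfFrame (f 0) (f.linear 1) (f.linear I) := by
  ext z
  rw [affineOfFrame_apply, ← map_smul, ← map_smul, ← map_add]
  have : f z = f.linear z + f 0 := by simpa using f.map_vadd 0 z
  rw [this]
  congr 2
  apply Complex.ext <;> simp

lemma squareTuple_affineOfFrame (c u v : ℂ) :
    squareTuple (affineOfFrame c u v) = ![c + u, c + v, c - u, c - v] := by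
  funext i
  fin_cases i <;> simp [squareTuple, affineOfFrame_apply, pow_succ] <;> ring

lemma squareTuple_balanced (f : ℂ →ᵃ[ℝ] ℂ) :
    squareTuple f 0 + squareTuple f 2 = squareTuple f 1 + squareTuple f 3 := by
  rw [eq_affineOfFrame f, squareTuple_affineOfFrame]
  simp

lemma squareTuple_injective : Function.Injective squareTuple := by
  intro f g h
  rw [eq_affineOfFrame f, eq_affineOfFrame g] at h ⊢
  rw [squareTuple_affineOfFrame, squareTuple_affineOfFrame] at h
  have h0 := congrFun h 0
  have h1 := congrFun h 1
  have h2 := congrFun h 2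
  have h3 := congrFun h 3
  simp only [Matrix.cons_val] at h0 h1 h2 h3
  have e0 : f 0 = g 0 := by linear_combination (h0 + h2) / 2
  have e1 : f.linear 1 = g.linear 1 := by linear_combination (h0 - h2) / 2
  have e2 : f.linear I = g.linear I := by linear_combination (h1 - h3) / 2
  rw [e0, e1, e2]

lemma exists_squareTuple_eq {x : Fin 4 → ℂ} (hx : x 0 + x 2 = x 1 + x 3) :
    ∃ f, squareTuple f = x := by
  refine ⟨affineOfFrame ((x 0 + x 2) / 2) ((x 0 - x 2) / 2) ((x 1 - x 3) / 2), ?_⟩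
  rw [squareTuple_affineOfFrame]
  funext i
  fin_cases i
  · simp; ring
  · simp; linear_combination hx / 2
  · simp; ring
  · simp; linear_combination hx / 2

lemma squareTuple_add (f g : ℂ →ᵃ[ℝ] ℂ) : squareTuple (f + g) = squareTuple f + squareTuple g := rfl

lemma squareTuple_smul (a : ℝ) (f : ℂ →ᵃ[ℝ] ℂ) :
    squareTuple (a • f) = a • squareTuple f := rfl

lemma regularPolygon_four :
    regularPolygon 4 = convexHull ℝ (Set.range fun k : Fin 4 => I ^ (k : ℕ)) := by
  unfold regularPolygon
  congr 2
  funext k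
  have h : 2 * Real.pi / (4 : ℕ) = Real.pi / 2 := by push_cast; ring
  rw [h]
  simp

lemma mem_homPolytope_iff (n : ℕ) (f : ℂ →ᵃ[ℝ] ℂ) :
    f ∈ homPolytope (regularPolygon 4) (regularPolygon n) ↔
      ∀ i, squareTuple f i ∈ regularPolygon n := by
  rw [homPolytope, Set.mem_ofPred_eq, Set.mapsTo_iff_image_subset, regularPolygon_four,
    AffineMap.image_convexHull]
  constructor
  · intro h i
    exact h (subset_convexHull _ _ ⟨_, ⟨i, rfl⟩, rfl⟩)
  · intro h
    apply convexHull_min _ (convex_regularPolygon n)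
    rintro _ ⟨_, ⟨i, rfl⟩, rfl⟩
    exact h i

lemma vectorSpan_square : vectorSpan ℝ (regularPolygon 4) = ⊤ := by
  rw [regularPolygon_four, ← direction_affineSpan, affineSpan_convexHull, direction_affineSpan,
    eq_top_iff]
  intro z _
  have h1 := vsub_mem_vectorSpan ℝ (s := Set.range fun k : Fin 4 => I ^ (k : ℕ))
    ⟨0, rfl⟩ ⟨2, rfl⟩
  have h2 := vsub_mem_vectorSpan ℝ (s := Set.range fun k : Fin 4 => I ^ (k : ℕ))
    ⟨1, rfl⟩ ⟨3, rfl⟩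
  have := Submodule.add_mem _ (Submodule.smul_mem _ (z.re / 2) h1)
    (Submodule.smul_mem _ (z.im / 2) h2)
  convert this using 1
  apply Complex.ext <;> simp [pow_succ]

lemma mapRank_eq_two_iff (f : ℂ →ᵃ[ℝ] ℂ) : mapRank (regularPolygon 4) f = 2 ↔
    planeDet (squareTuple f 0 - squareTuple f 2) (squareTuple f 1 - squareTuple f 3) ≠ 0 := by
  have h0 : mapRank (regularPolygon 4) f = 2 ↔ LinearMap.ker f.linear = ⊥ := by
    rw [mapRank, ← AffineMap.map_vectorSpan, vectorSpan_square,
      Submodule.map_top]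
    have := f.linear.finrank_range_add_finrank_ker
    rw [Complex.finrank_real_complex] at this
    rw [← Submodule.finrank_eq_zero (R := ℝ)]
    omega
  have h1 : planeDet (squareTuple f 0 - squareTuple f 2) (squareTuple f 1 - squareTuple f 3)
      = 4 * planeDet (f.linear 1) (f.linear I) := by
    conv_lhs => rw [eq_affineOfFrame f, squareTuple_affineOfFrame]
    simp [planeDet]; ring
  have h2 (z : ℂ) : f.linear z = z.re • f.linear 1 + z.im • f.linear I := by
    rw [← map_smul, ← map_smul, ← map_add]
    congr 1
    apply Complex.ext <;> simp
  rw [h0, h1, LinearMap.ker_eq_bot']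
  constructor
  · intro h hdet
    have hdet : planeDet (f.linear 1) (f.linear I) = 0 := by linarith
    unfold planeDet at hdet
    -- When the determinant vanishes, these cofactor vectors lie in the kernel; if both are zero, so
    -- is `f.linear 1`.
    have hre := h ⟨(f.linear I).re, -(f.linear 1).re⟩ (by
      rw [h2]
      apply Complex.ext <;> simp <;> linarith)
    have him := h ⟨(f.linear I).im, -(f.linear 1).im⟩ (by
      rw [h2]
      apply Complex.ext <;> simp <;> linarith)
    have h3 : f.linear 1 = 0 := by
      apply Complex.ext
      · simpa using congrArg Complex.im hre
      · simpa using congrArg Complex.im him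
    exact one_ne_zero (h 1 h3)
  · intro hdet z hz
    have hdet : planeDet (f.linear 1) (f.linear I) ≠ 0 := fun h => hdet (by rw [h, mul_zero])
    rw [h2] at hz
    have hre := congrArg Complex.re hz
    have him := congrArg Complex.im hz
    simp only [add_re, add_im, smul_re, smul_im, smul_eq_mul, zero_re, zero_im] at hre him
    apply Complex.ext <;> apply mul_left_cancel₀ hdet <;> unfold planeDet
    · rw [zero_re, mul_zero]
      linear_combination (f.linear I).im * hre - (f.linear I).re * him
    · rw [zero_im, mul_zero]
      linear_combination (f.linear 1).re * him - (f.linear 1).im * hre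

/-! ### Free motions and the rigidity criterion for extreme points -/

/-- A direction in which a point of the polygon can be moved both ways. -/
def FreeDir (n : ℕ) (z v : ℂ) : Prop :=
  ∃ ε > 0, ∀ δ : ℝ, |δ| ≤ ε → z + δ • v ∈ regularPolygon n

variable {n : ℕ}

lemma FreeDir.smul {z v : ℂ} (h : FreeDir n z v) (a : ℝ) : FreeDir n z (a • v) := by
  obtain ⟨ε, hε, h⟩ := h
  refine ⟨ε / (|a| + 1), by positivity, fun δ hδ => ?_⟩
  rw [smul_smul]
  apply h
  rw [abs_mul]
  rw [le_div_iff₀ (by positivity)] at hδ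
  nlinarith [abs_nonneg a, abs_nonneg δ]

lemma freeDir_zero {z : ℂ} (hz : z ∈ regularPolygon n) : FreeDir n z 0 :=
  ⟨1, one_pos, fun δ _ => by simpa using hz⟩

lemma OpenEdge.freeDir (hn : 3 ≤ n) {t : ℤ} {z : ℂ} (h : OpenEdge n t z) :
    FreeDir n z (cis n (2 * t + 2) - cis n (2 * t)) := by
  obtain ⟨a, b, ha, hb, hab, rfl⟩ := h
  refine ⟨min a b, lt_min ha hb, fun δ hδ => ?_⟩
  obtain ⟨h1, h2⟩ := abs_le.mp hδ
  have h3 := min_le_left a b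
  have h4 := min_le_right a b
  have := sector_mem hn t (a := a - δ) (b := b + δ) (by linarith) (by linarith) (by linarith)
  convert this using 1
  module

lemma abs_proj_le (s : ℤ) (z : ℂ) : |proj n s z| ≤ |z.re| + |z.im| := by
  unfold proj
  refine (abs_add_le _ _).trans ?_
  rw [abs_mul, abs_mul]
  have h1 := Real.abs_cos_le_one (s * (Real.pi / n))
  have h2 := Real.abs_sin_le_one (s * (Real.pi / n))
  nlinarith [abs_nonneg z.re, abs_nonneg z.im]

/-- A displacement `δ • v` changes every projection by at most `|δ| * (|v.re| + |v.im|)`, uniformly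
in the edge. -/
lemma freeDir_of_gap (hn : 3 ≤ n) {z : ℂ} {ε : ℝ} (hε : 0 < ε)
    (h : ∀ t : ℤ, proj n (2 * t + 1) z + ε ≤ Real.cos (Real.pi / n)) (v : ℂ) : FreeDir n z v := by
  have hpos : 0 < |v.re| + |v.im| + 1 := by positivity
  refine ⟨ε / (|v.re| + |v.im| + 1), by positivity, fun δ hδ => ?_⟩
  rw [mem_regularPolygon_iff hn]
  intro t
  rw [proj_add, proj_smul]
  rw [le_div_iff₀ hpos] at hδ
  have h1 := abs_proj_le (n := n) (2 * t + 1) v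
  have h2 : δ * proj n (2 * t + 1) v ≤ |δ| * |proj n (2 * t + 1) v| := by
    rw [← abs_mul]; exact le_abs_self _
  have := h t
  nlinarith [abs_nonneg δ, abs_nonneg (proj n (2 * t + 1) v)]

lemma edge_ne_zero (hn : 3 ≤ n) (t : ℤ) : cis n (2 * t + 2) - cis n (2 * t) ≠ 0 := by
  rw [sub_ne_zero, Ne, cis_eq_iff (by omega)]
  intro h
  have := Int.le_of_dvd (by omega) h
  omega

/-- The two edges differ by a rotation through a multiple of `π`, that is, by a sign. -/
lemma edge_parallel (hn : 3 ≤ n) {s t : ℤ} (h : (n : ℤ) ∣ 2 * (s - t)) :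
    ∃ a : ℝ, cis n (2 * s + 2) - cis n (2 * s) = a • (cis n (2 * t + 2) - cis n (2 * t)) := by
  obtain ⟨k, hk⟩ := h
  rw [show 2 * s = n * k + 2 * t by linarith, add_assoc]
  have h : cis n (n * k) = 1 ∨ cis n (n * k) = -1 := by
    rcases Int.even_or_odd' k with ⟨l, rfl | rfl⟩
    · left
      have := cis_add_two_mul (n := n) (by omega) 0 l
      rw [← cis_zero (n := n), ← this]
      congr 1; ring
    · right
      have := cis_add_two_mul (n := n) (by omega) n l
      rw [← cis_self (n := n) (by omega), ← this]
      congr 1; ring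
  rw [cis_add _ (2 * t + 2), cis_add _ (2 * t)]
  rcases h with h | h
  · exact ⟨1, by rw [h]; simp⟩
  · exact ⟨-1, by rw [h]; simp; ring⟩

/-- The normals of non-parallel edges are linearly independent, because the sine of the angle
between them is nonzero; Cramer's rule finishes. -/
lemma eq_zero_of_proj_eq_zero (hn : 3 ≤ n) {s t : ℤ} (h : ¬ (n : ℤ) ∣ 2 * (s - t)) {w : ℂ}
    (hs : proj n (2 * s + 1) w = 0) (ht : proj n (2 * t + 1) w = 0) : w = 0 := by
  have hd : Real.sin ((2 * s + 1 : ℤ) * (Real.pi / n) - (2 * t + 1 : ℤ) * (Real.pi / n)) ≠ 0 := by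
    intro h0
    have h1 : Real.cos ((2 * (2 * (s - t)) : ℤ) * (Real.pi / n)) = 1 := by
      rw [show ((2 * (2 * (s - t)) : ℤ) : ℝ) * (Real.pi / n) = 2 * ((2 * s + 1 : ℤ) * (Real.pi / n)
        - (2 * t + 1 : ℤ) * (Real.pi / n)) by push_cast; ring, Real.cos_two_mul,
        Real.cos_sq', h0]
      norm_num
    rw [cos_eq_one_iff_dvd (by omega)] at h1
    exact h ((mul_dvd_mul_iff_left two_ne_zero).mp h1)
  rw [Real.sin_sub] at hd
  unfold proj at hs ht
  apply Complex.ext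
  · apply mul_left_cancel₀ hd
    rw [zero_re, mul_zero]
    linear_combination Real.sin ((2 * s + 1 : ℤ) * (Real.pi / n)) * ht -
      Real.sin ((2 * t + 1 : ℤ) * (Real.pi / n)) * hs
  · apply mul_left_cancel₀ hd
    rw [zero_im, mul_zero]
    linear_combination Real.cos ((2 * t + 1 : ℤ) * (Real.pi / n)) * hs -
      Real.cos ((2 * s + 1 : ℤ) * (Real.pi / n)) * ht

/-- A vertex of the polygon is an extreme point. -/
lemma vertex_eq_of_mem_openSegment {v y z : ℂ} (hv : v ∈ polygonVertices n)
    (hy : y ∈ regularPolygon n) (hz : z ∈ regularPolygon n) (h : v ∈ openSegment ℝ y z) :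
    y = v := by
  obtain ⟨k, rfl⟩ := hv
  obtain ⟨a, b, ha, hb, hab, h⟩ := h
  -- Expand the square and use `‖w‖ ≤ 1`. The right-hand sides at `y` and `z` have weighted mean
  -- zero.
  have key (w : ℂ) (hw : w ∈ regularPolygon n) : ‖w - cis n (2 * k)‖ ^ 2
      ≤ 2 * (1 - proj n (2 * k) w) := by
    have h1 := normSq_le hw
    have h2 := cis_sq_add_sq (n := n) (2 * k)
    rw [← Complex.normSq_eq_norm_sq, Complex.normSq_apply]
    simp only [sub_re, sub_im, cis_re, cis_im, proj]
    nlinarith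
  have h1 := key y hy
  have h2 := key z hz
  have h3 : a * proj n (2 * k) y + b * proj n (2 * k) z = 1 := by
    rw [← proj_smul, ← proj_smul, ← proj_add, h, proj_cis]
    simp
  have : ‖y - cis n (2 * k)‖ ^ 2 ≤ 0 := by
    have hb' : b = 1 - a := by linarith
    subst hb'
    nlinarith [sq_nonneg ‖y - cis n (2 * k)‖, sq_nonneg ‖z - cis n (2 * k)‖]
  have : ‖y - cis n (2 * k)‖ = 0 := by nlinarith [norm_nonneg (y - cis n (2 * k))]
  rwa [norm_eq_zero, sub_eq_zero] at this

lemma edge_proj_eq_of_mem_openSegment (hn : 3 ≤ n) {v y z : ℂ} {t : ℤ} (hv : OpenEdge n t v)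
    (hy : y ∈ regularPolygon n) (hz : z ∈ regularPolygon n) (h : v ∈ openSegment ℝ y z) :
    proj n (2 * t + 1) (y - v) = 0 := by
  obtain ⟨a, b, ha, hb, hab, h⟩ := h
  have h1 := proj_le hn t hy
  have h2 := proj_le hn t hz
  have h3 := hv.proj_eq
  rw [proj_sub, h3]
  rw [← h, proj_add, proj_smul, proj_smul] at h3
  have hb' : b = 1 - a := by linarith
  subst hb'
  nlinarith

/-- The signs of the four vertices of a parallelogram in its defining relation. -/
def altSign (i : Fin 4) : ℝ := ![1, -1, 1, -1] i

lemma altSign_mul_self (i : Fin 4) : altSign i * altSign i = 1 := by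
  fin_cases i <;> simp [altSign]

/-- Attaching alternating signs turns the parallelogram relation into the symmetric condition `∑ i,
w i = 0`. The signed motion then comes from an affine map `g`, and `f` is the midpoint of `f + δ •
g` and `f - δ • g`, so `g = 0`. -/
lemma extremePoint_rigid {f : ℂ →ᵃ[ℝ] ℂ}
    (hf : f ∈ (homPolytope (regularPolygon 4) (regularPolygon n)).extremePoints ℝ)
    {w : Fin 4 → ℂ} (hw : ∑ i, w i = 0) (hfree : ∀ i, FreeDir n (squareTuple f i) (w i)) :
    w = 0 := by
  have hfree' (i) : FreeDir n (squareTuple f i) (altSign i • w i) := (hfree i).smul _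
  choose ε hε h using hfree'
  obtain ⟨δ, hδ, hδε⟩ : ∃ δ > 0, ∀ i, δ ≤ ε i := by
    refine ⟨min (min (ε 0) (ε 1)) (min (ε 2) (ε 3)), ?_, fun i => ?_⟩
    · simp [hε]
    · fin_cases i <;> simp
  rw [Fin.sum_univ_four] at hw
  obtain ⟨g, hg⟩ := exists_squareTuple_eq (x := fun i => altSign i • w i)
    (by simp [altSign]; linear_combination hw)
  have hmem (a : ℝ) (ha : |a| ≤ δ) :
      f + a • g ∈ homPolytope (regularPolygon 4) (regularPolygon n) := by
    rw [mem_homPolytope_iff]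
    intro i
    rw [squareTuple_add, squareTuple_smul, hg]
    exact h i a (ha.trans (hδε i))
  rw [mem_extremePoints] at hf
  have h1 := hf.2 _ (hmem δ (abs_of_pos hδ).le) _ (hmem (-δ) (by rw [abs_neg, abs_of_pos hδ]))
    ⟨1 / 2, 1 / 2, by norm_num, by norm_num, by norm_num, by module⟩
  have h2 : δ • g = 0 := by simpa using h1.1
  have h3 : g = 0 := by
    rcases smul_eq_zero.mp h2 with h | h
    · exact absurd h hδ.ne'
    · exact h
  funext i
  have h4 := congrFun hg i
  rw [h3] at h4
  have h5 : altSign i • w i = 0 := by simpa [squareTuple] using h4.symm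
  have := congrArg (altSign i • ·) h5
  rw [smul_zero] at this
  simpa only [smul_smul, altSign_mul_self, one_smul, Pi.zero_apply] using this

/-- The description of the vertices of the hom-polytope in terms of the images of the four
vertices of the square. -/
def IsRigid (n : ℕ) (x : Fin 4 → ℂ) : Prop :=
  (∃ p, ∀ i, i ≠ p → x i ∈ polygonVertices n) ∨
    ∃ p q s t, p ≠ q ∧ OpenEdge n s (x p) ∧ OpenEdge n t (x q) ∧ ¬ (n : ℤ) ∣ 2 * (s - t) ∧
      ∀ i, i ≠ p → i ≠ q → x i ∈ polygonVertices n

/-- Two corners with a common free direction can be moved together, so two non-vertex corners must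
lie on non-parallel open edges. A third non-vertex corner is excluded because three vectors in the
plane are always linearly dependent. -/
lemma isRigid_of_mem_extremePoints (hn : 3 ≤ n) {f : ℂ →ᵃ[ℝ] ℂ}
    (hf : f ∈ (homPolytope (regularPolygon 4) (regularPolygon n)).extremePoints ℝ) :
    IsRigid n (squareTuple f) := by
  set x := squareTuple f with hx
  have hQ : ∀ i, x i ∈ regularPolygon n := by
    rw [← mem_homPolytope_iff]; exact extremePoints_subset hf
  have pair {p q : Fin 4} (hpq : p ≠ q) {v : ℂ} (hp : FreeDir n (x p) v)
      (hq : FreeDir n (x q) v) : v = 0 := by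
    have := extremePoint_rigid hf (w := Pi.single p v + Pi.single q ((-1 : ℝ) • v))
      (by simp [Finset.sum_add_distrib]) (fun i => by
        by_cases h1 : i = p
        · subst h1; simpa [hpq] using hp
        · by_cases h2 : i = q
          · subst h2; simpa [Ne.symm hpq] using hq.smul (-1)
          · simpa [h1, h2] using freeDir_zero (hQ i))
    simpa [hpq] using congrFun this p
  have edge {p q : Fin 4} (hpq : p ≠ q) (hp : x p ∉ polygonVertices n)
      (hq : x q ∉ polygonVertices n) : ∃ t, OpenEdge n t (x p) := by
    rcases regularPolygon_trichotomy hn (hQ p) with h | h | ⟨ε, hε, h⟩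
    · exact absurd h hp
    · exact h
    · exfalso
      have hall := freeDir_of_gap hn hε h
      rcases regularPolygon_trichotomy hn (hQ q) with h' | ⟨t, ht⟩ | ⟨ε', hε', h'⟩
      · exact hq h'
      · exact edge_ne_zero hn t (pair hpq (hall _) (ht.freeDir hn))
      · exact one_ne_zero (pair hpq (hall 1) (freeDir_of_gap hn hε' h' 1))
  by_cases h3 : ∃ p, ∀ i, i ≠ p → x i ∈ polygonVertices n
  · exact Or.inl h3
  right
  push Not at h3
  obtain ⟨p, -, hp⟩ := h3 0
  obtain ⟨q, hqp, hq⟩ := h3 p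
  obtain ⟨s, hs⟩ := edge hqp.symm hp hq
  obtain ⟨t, ht⟩ := edge hqp hq hp
  refine ⟨p, q, s, t, hqp.symm, hs, ht, fun hd => ?_, fun r hrp hrq => ?_⟩
  · obtain ⟨a, ha⟩ := edge_parallel hn hd
    refine edge_ne_zero hn s (pair hqp.symm (hs.freeDir hn) ?_)
    rw [ha]
    exact (ht.freeDir hn).smul a
  · by_contra hr
    obtain ⟨u, hu⟩ := edge hrp hr hp
    have hs0 := edge_ne_zero hn s
    have ht0 := edge_ne_zero hn t
    have hu0 := edge_ne_zero hn u
    have hs' := hs.freeDir hn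
    have ht' := ht.freeDir hn
    have hu' := hu.freeDir hn
    set es := cis n (2 * s + 2) - cis n (2 * s)
    set et := cis n (2 * t + 2) - cis n (2 * t)
    set eu := cis n (2 * u + 2) - cis n (2 * u)
    -- The identity `det(s,t) u + det(t,u) s + det(u,s) t = 0` supplies a motion with zero sum;
    -- rigidity kills its coefficient at `eu`.
    have hdet : planeDet es et = 0 := by
      have := extremePoint_rigid hf (w := Pi.single r (planeDet es et • eu) +
        Pi.single p (planeDet et eu • es) + Pi.single q (planeDet eu es • et))
        (by
          simp only [Pi.add_apply, Finset.sum_add_distrib, Finset.sum_pi_single',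
            Finset.mem_univ, if_true]
          apply Complex.ext <;> simp [planeDet] <;> ring) (fun i => by
          by_cases h1 : i = r
          · subst h1; simpa [hrp, hrq] using hu'.smul _
          · by_cases h2 : i = p
            · subst h2; simpa [h1, hqp.symm] using hs'.smul _
            · by_cases h3 : i = q
              · subst h3; simpa [h1, h2] using ht'.smul _
              · simpa [h1, h2, h3] using freeDir_zero (hQ i))
      have := congrFun this r
      simpa [hrp, hrq, hu0] using this
    -- A zero determinant makes `es` and `et` parallel, so their common multiples are free
    -- directions at both `p` and `q`, which forces `et = 0`.
    have hre : et.re • es = es.re • et := by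
      apply Complex.ext
      · simp; ring
      · simp only [planeDet] at hdet; simp; linarith
    have him : et.im • es = es.im • et := by
      apply Complex.ext
      · simp only [planeDet] at hdet; simp; linarith
      · simp; ring
    have h1 := pair hqp.symm (hs'.smul et.re) (hre ▸ ht'.smul es.re)
    have h2 := pair hqp.symm (hs'.smul et.im) (him ▸ ht'.smul es.im)
    rw [smul_eq_zero, or_iff_left hs0] at h1 h2
    exact ht0 (Complex.ext h1 h2)

/-- On a segment through `f`, vertex corners stay fixed and edge corners stay on their edge lines.
The parallelogram relation then fixes a single remaining corner, or equates up to sign two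
displacements along non-parallel lines, so both vanish. -/
lemma mem_extremePoints_of_isRigid (hn : 3 ≤ n) {f : ℂ →ᵃ[ℝ] ℂ}
    (hQ : ∀ i, squareTuple f i ∈ regularPolygon n) (h : IsRigid n (squareTuple f)) :
    f ∈ (homPolytope (regularPolygon 4) (regularPolygon n)).extremePoints ℝ := by
  rw [mem_extremePoints_iff_left]
  refine ⟨(mem_homPolytope_iff n f).mpr hQ, fun g hg k hk hf => squareTuple_injective ?_⟩
  rw [mem_homPolytope_iff] at hg hk
  have hseg (i) : squareTuple f i ∈ openSegment ℝ (squareTuple g i) (squareTuple k i) := by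
    obtain ⟨a, b, ha, hb, hab, h⟩ := hf
    exact ⟨a, b, ha, hb, hab, by rw [← h]; rfl⟩
  have hvert (i) (hi : squareTuple f i ∈ polygonVertices n) : squareTuple g i = squareTuple f i :=
    vertex_eq_of_mem_openSegment hi (hg i) (hk i) (hseg i)
  have hbal : ∑ i, altSign i • (squareTuple g i - squareTuple f i) = 0 := by
    have h1 := squareTuple_balanced f
    have h2 := squareTuple_balanced g
    simp [Fin.sum_univ_four, altSign]
    linear_combination h2 - h1
  rcases h with ⟨p, hp⟩ | ⟨p, q, s, t, hpq, hs, ht, hd, hv⟩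
  · have hsum : ∑ i, altSign i • (squareTuple g i - squareTuple f i) =
        altSign p • (squareTuple g p - squareTuple f p) := by
      apply Finset.sum_eq_single p
      · intro i _ hi
        rw [hvert i (hp i hi), sub_self, smul_zero]
      · simp
    rw [hbal] at hsum
    have := congrArg (altSign p • ·) hsum
    rw [smul_zero] at this
    simp only [smul_smul, altSign_mul_self, one_smul] at this
    funext i
    by_cases hi : i = p
    · subst hi; exact (sub_eq_zero.mp this.symm)
    · exact hvert i (hp i hi)
  · have hsum : ∑ i, altSign i • (squareTuple g i - squareTuple f i) =
        altSign p • (squareTuple g p - squareTuple f p) +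
        altSign q • (squareTuple g q - squareTuple f q) := by
      apply Fintype.sum_eq_add p q hpq
      rintro i ⟨hi, hi'⟩
      rw [hvert i (hv i hi hi'), sub_self, smul_zero]
    rw [hbal] at hsum
    have h1 := edge_proj_eq_of_mem_openSegment hn hs (hg p) (hk p) (hseg p)
    have h2 := edge_proj_eq_of_mem_openSegment hn ht (hg q) (hk q) (hseg q)
    have hp0 : altSign p • (squareTuple g p - squareTuple f p) = 0 := by
      refine eq_zero_of_proj_eq_zero hn hd (by rw [proj_smul, h1, mul_zero]) ?_
      rw [eq_neg_of_add_eq_zero_left hsum.symm, proj_neg, proj_smul, h2]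
      simp
    have hq0 : altSign q • (squareTuple g q - squareTuple f q) = 0 := by
      rw [hp0, zero_add] at hsum; exact hsum.symm
    have key (r) (h : altSign r • (squareTuple g r - squareTuple f r) = 0) :
        squareTuple g r = squareTuple f r := by
      have := congrArg (altSign r • ·) h
      rw [smul_zero] at this
      simpa only [smul_smul, altSign_mul_self, one_smul, sub_eq_zero] using this
    funext i
    by_cases hi : i = p
    · subst hi; exact key _ hp0
    · by_cases hi' : i = q
      · subst hi'; exact key _ hq0
      · exact hvert i (hv i hi hi')

/-- The quadruples of points that describe the vertices of rank two of the hom-polytope. -/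
def vertexTuples (n : ℕ) : Set (Fin 4 → ℂ) :=
  {x | (∀ i, x i ∈ regularPolygon n) ∧ x 0 + x 2 = x 1 + x 3 ∧ IsRigid n x ∧
    planeDet (x 0 - x 2) (x 1 - x 3) ≠ 0}

lemma image_squareTuple (hn : 3 ≤ n) :
    squareTuple '' verticesOfRank (regularPolygon 4) (regularPolygon n) 2 = vertexTuples n := by
  ext x
  constructor
  · rintro ⟨f, ⟨hf, hr⟩, rfl⟩
    exact ⟨(mem_homPolytope_iff n f).mp (extremePoints_subset hf), squareTuple_balanced f,
      isRigid_of_mem_extremePoints hn hf, (mapRank_eq_two_iff f).mp hr⟩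
  · rintro ⟨h1, h2, h3, h4⟩
    obtain ⟨f, rfl⟩ := exists_squareTuple_eq h2
    exact ⟨f, ⟨mem_extremePoints_of_isRigid hn h1 h3, (mapRank_eq_two_iff f).mpr h4⟩, rfl⟩

end

/-! ### Parallelograms with three corners at polygon vertices -/

noncomputable section

open Complex

section geometry

variable {n : ℕ}

/-- The inner product of `z` with `I * cis n s`. -/
def perp (n : ℕ) (s : ℤ) (z : ℂ) : ℝ :=
  z.im * Real.cos (s * (Real.pi / n)) - z.re * Real.sin (s * (Real.pi / n))

lemma perp_add (s : ℤ) (z w : ℂ) : perp n s (z + w) = perp n s z + perp n s w := by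
  simp [perp]; ring

lemma perp_smul (s : ℤ) (a : ℝ) (z : ℂ) : perp n s (a • z) = a * perp n s z := by
  simp [perp]; ring

lemma perp_cis (s t : ℤ) : perp n s (cis n t) = Real.sin ((t - s : ℤ) * (Real.pi / n)) := by
  simp [perp, sub_mul, Real.sin_sub]

lemma proj_sq_add_perp_sq (s : ℤ) (z : ℂ) :
    proj n s z ^ 2 + perp n s z ^ 2 = z.re ^ 2 + z.im ^ 2 := by
  have := cis_sq_add_sq (n := n) s
  unfold proj perp
  linear_combination (z.re ^ 2 + z.im ^ 2) * this

lemma planeDet_eq (s : ℤ) (z w : ℂ) :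
    planeDet z w = proj n s z * perp n s w - perp n s z * proj n s w := by
  have := cis_sq_add_sq (n := n) s
  unfold proj perp planeDet
  linear_combination (-(z.re * w.im - z.im * w.re)) * this

lemma proj_eq_proj_perp (s t : ℤ) (z : ℂ) : proj n t z =
    proj n s z * Real.cos ((t - s : ℤ) * (Real.pi / n)) +
      perp n s z * Real.sin ((t - s : ℤ) * (Real.pi / n)) := by
  have := cis_sq_add_sq (n := n) s
  push_cast
  rw [sub_mul, Real.cos_sub, Real.sin_sub]
  unfold proj perp
  linear_combination (-(z.re * Real.cos (t * (Real.pi / n)) +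
    z.im * Real.sin (t * (Real.pi / n)))) * this

lemma ext_proj_perp (s : ℤ) {z w : ℂ} (h1 : proj n s z = proj n s w)
    (h2 : perp n s z = perp n s w) : z = w := by
  have := cis_sq_add_sq (n := n) s
  unfold proj at h1
  unfold perp at h2
  apply Complex.ext
  · linear_combination Real.cos (s * (Real.pi / n)) * h1 - Real.sin (s * (Real.pi / n)) * h2 -
      (z.re - w.re) * this
  · linear_combination Real.sin (s * (Real.pi / n)) * h1 + Real.cos (s * (Real.pi / n)) * h2 -
      (z.im - w.im) * this

lemma proj_cis_mul (s k : ℤ) (z : ℂ) : proj n s (cis n k * z) = proj n (s - k) z := by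
  simp [proj, sub_mul, Real.cos_sub, Real.sin_sub]; ring

lemma dvd_of_sin_eq_zero (hn : 3 ≤ n) {m : ℤ} (h : Real.sin (m * (Real.pi / n)) = 0) :
    (n : ℤ) ∣ m := by
  have h1 : Real.cos ((2 * m : ℤ) * (Real.pi / n)) = 1 := by
    rw [show ((2 * m : ℤ) : ℝ) * (Real.pi / n) = 2 * (m * (Real.pi / n)) by push_cast; ring,
      Real.cos_two_mul, Real.cos_sq', h]
    norm_num
  rw [cos_eq_one_iff_dvd (by omega)] at h1
  exact (mul_dvd_mul_iff_left two_ne_zero).mp h1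

lemma dvd_of_cos_eq_zero (hn : 3 ≤ n) {m : ℤ} (h : Real.cos (m * (Real.pi / n)) = 0) :
    (n : ℤ) ∣ 2 * m := by
  apply dvd_of_sin_eq_zero hn
  rw [show ((2 * m : ℤ) : ℝ) * (Real.pi / n) = 2 * (m * (Real.pi / n)) by push_cast; ring,
      Real.sin_two_mul, h]
  ring

lemma mul_pi_div_le (hn : 3 ≤ n) {m k : ℤ} (h : m ≤ k) :
    (m : ℝ) * (Real.pi / n) ≤ k * (Real.pi / n) := by
  have := pi_div_pos hn
  have : (m : ℝ) ≤ k := by exact_mod_cast h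
  gcongr

lemma natCast_mul_pi_div (hn : 3 ≤ n) : ((n : ℤ) : ℝ) * (Real.pi / n) = Real.pi := by
  have : (n : ℝ) ≠ 0 := by
    have : n ≠ 0 := by omega
    exact_mod_cast this
  push_cast; field_simp

lemma sin_int_pos (hn : 3 ≤ n) {m : ℤ} (h0 : 0 < m) (h1 : m < n) :
    0 < Real.sin (m * (Real.pi / n)) := by
  have h2 : (0 : ℝ) < m := by exact_mod_cast h0
  have h3 : (m : ℝ) < n := by exact_mod_cast h1
  have := pi_div_pos hn
  apply Real.sin_pos_of_pos_of_lt_pi (by positivity)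
  calc (m : ℝ) * (Real.pi / n) < n * (Real.pi / n) := by gcongr
    _ = Real.pi := by simpa using natCast_mul_pi_div hn

lemma cos_int_pos (hn : 3 ≤ n) {m : ℤ} (h0 : 0 ≤ m) (h1 : 2 * m < n) :
    0 < Real.cos (m * (Real.pi / n)) := by
  have h2 : (0 : ℝ) ≤ m := by exact_mod_cast h0
  have h3 : 2 * (m : ℝ) < n := by exact_mod_cast h1
  have := pi_div_pos hn
  have := natCast_mul_pi_div hn
  push_cast at this
  apply Real.cos_pos_of_mem_Ioo
  constructor
  · have : 0 ≤ m * (Real.pi / n) := by positivity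
    linarith [Real.pi_pos]
  · nlinarith

lemma cos_int_neg (hn : 3 ≤ n) {m : ℤ} (h0 : n < 2 * m) (h1 : m ≤ n) :
    Real.cos (m * (Real.pi / n)) < 0 := by
  have := cos_int_pos hn (m := n - m) (by omega) (by omega)
  push_cast at this
  have h := natCast_mul_pi_div hn
  push_cast at h
  rw [sub_mul, h, Real.cos_pi_sub] at this
  linarith

lemma sin_int_le (hn : 3 ≤ n) {m k : ℤ} (h0 : 0 ≤ m) (h1 : m ≤ k) (h2 : k ≤ n - m) :
    Real.sin (m * (Real.pi / n)) ≤ Real.sin (k * (Real.pi / n)) := by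
  have e1 := mul_pi_div_le hn h0
  have e2 := mul_pi_div_le hn h1
  have e3 := mul_pi_div_le hn h2
  have h := natCast_mul_pi_div hn
  push_cast at e1 e3 h
  rw [sub_mul, h] at e3
  rw [zero_mul] at e1
  generalize (m : ℝ) * (Real.pi / n) = x at *
  generalize (k : ℝ) * (Real.pi / n) = y at *
  have hd := Real.sin_sub_sin y x
  have s1 : 0 ≤ Real.sin ((y - x) / 2) := by
    apply Real.sin_nonneg_of_nonneg_of_le_pi <;> linarith
  have s2 : 0 ≤ Real.cos ((y + x) / 2) := by
    apply Real.cos_nonneg_of_neg_pi_div_two_le_of_le <;> linarith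
  have : 0 ≤ 2 * Real.sin ((y - x) / 2) * Real.cos ((y + x) / 2) := by positivity
  linarith

lemma cis_mul_mem (hn : 3 ≤ n) (k : ℤ) {z : ℂ} (hz : z ∈ regularPolygon n) :
    cis n (2 * k) * z ∈ regularPolygon n := by
  rw [mem_regularPolygon_iff hn]
  intro t
  rw [proj_cis_mul, show 2 * t + 1 - 2 * k = 2 * (t - k) + 1 by ring]
  exact proj_le hn _ hz

/-- The squared norm of the fourth vertex of a parallelogram with three vertices on the unit
circle. -/
lemma normSq_fourth (k p q : ℤ) :
    (cis n (2 * k + 2 * p) + cis n (2 * k + 2 * q) - cis n (2 * k)).re ^ 2 +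
      (cis n (2 * k + 2 * p) + cis n (2 * k + 2 * q) - cis n (2 * k)).im ^ 2 =
    1 + 8 * Real.sin (p * (Real.pi / n)) * Real.sin (q * (Real.pi / n)) *
      Real.cos ((p - q : ℤ) * (Real.pi / n)) := by
  have e : cis n (2 * k + 2 * p) + cis n (2 * k + 2 * q) - cis n (2 * k) =
      cis n (2 * k) * (cis n (2 * p) + cis n (2 * q) - 1) := by
    rw [cis_add, cis_add]; ring
  have h := cis_sq_add_sq (n := n) (2 * k)
  have h1 := Real.sin_sq_add_cos_sq (p * (Real.pi / n))
  have h2 := Real.sin_sq_add_cos_sq (q * (Real.pi / n))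
  have e1 : ((2 * p : ℤ) : ℝ) * (Real.pi / n) = 2 * (p * (Real.pi / n)) := by push_cast; ring
  have e2 : ((2 * q : ℤ) : ℝ) * (Real.pi / n) = 2 * (q * (Real.pi / n)) := by push_cast; ring
  rw [e]
  trans (cis n (2 * p) + cis n (2 * q) - 1).re ^ 2 + (cis n (2 * p) + cis n (2 * q) - 1).im ^ 2
  · simp only [mul_re, mul_im, cis_re, cis_im]
    linear_combination ((cis n (2 * p) + cis n (2 * q) - 1).re ^ 2 +
      (cis n (2 * p) + cis n (2 * q) - 1).im ^ 2) * h
  · simp only [add_re, add_im, sub_re, sub_im, cis_re, cis_im, one_re, one_im, e1, e2]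
    push_cast
    rw [sub_mul, Real.cos_sub]
    generalize (p : ℝ) * (Real.pi / n) = x at *
    generalize (q : ℝ) * (Real.pi / n) = y at *
    rw [Real.cos_two_mul, Real.cos_two_mul, Real.sin_two_mul, Real.sin_two_mul]
    have e3 : Real.cos x ^ 2 = 1 - Real.sin x ^ 2 := by linarith
    have e4 : Real.cos y ^ 2 = 1 - Real.sin y ^ 2 := by linarith
    rw [e3, e4]
    ring_nf
    rw [e3, e4]
    ring

/-- After rotating the middle corner to `1`, the side from `cis n (2 * p)` to the fourth corner is
parallel to the chord from `cis n (2 * p)` to `cis n (2 * (q - p))`. Half their lengths are the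
sines `s` and `S`, and the hypothesis makes the side no longer than the chord, so the fourth corner
lies on the chord. -/
lemma fourth_mem_of_le (hn : 3 ≤ n) (k : ℤ) {p q : ℤ} (hq : 0 < q) (hp : p < n)
    (h : n ≤ 2 * (p - q)) :
    cis n (2 * k + 2 * p) + cis n (2 * k + 2 * q) - cis n (2 * k) ∈ regularPolygon n := by
  have e : cis n (2 * k + 2 * p) + cis n (2 * k + 2 * q) - cis n (2 * k) =
      cis n (2 * k) * (cis n (2 * p) + cis n (2 * q) - 1) := by
    rw [cis_add, cis_add]; ring
  rw [e]
  apply cis_mul_mem hn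
  have h1 := sin_int_pos hn hq (by omega)
  -- A full turn brings `q - 2 * p` into the range from `q` to `n - q`.
  have h2 := sin_int_le hn (m := q) (k := q - 2 * p + 2 * n * 1) hq.le (by omega) (by omega)
  have h3 := congrArg Complex.im (cis_add_two_mul (n := n) (by omega) (q - 2 * p) 1)
  simp only [cis_im] at h3
  rw [h3] at h2
  set S := Real.sin ((q - 2 * p : ℤ) * (Real.pi / n)) with hS
  set s := Real.sin (q * (Real.pi / n)) with hs
  have hS0 : 0 < S := by linarith
  have key : cis n (2 * p) + cis n (2 * q) - 1 =
      (1 - s / S) • cis n (2 * p) + (s / S) • cis n (2 * (q - p)) := by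
    obtain ⟨x, hx⟩ : ∃ x : ℝ, x = q * (Real.pi / n) := ⟨_, rfl⟩
    obtain ⟨y, hy⟩ : ∃ y : ℝ, y = (q - 2 * p : ℤ) * (Real.pi / n) := ⟨_, rfl⟩
    rw [← hx] at hs
    rw [← hy] at hS
    have e1 : ((2 * p : ℤ) : ℝ) * (Real.pi / n) = x - y := by rw [hx, hy]; push_cast; ring
    have e2 : ((2 * q : ℤ) : ℝ) * (Real.pi / n) = 2 * x := by rw [hx]; push_cast; ring
    have e3 : ((2 * (q - p) : ℤ) : ℝ) * (Real.pi / n) = x + y := by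
      rw [hx, hy]; push_cast; ring
    have hx1 := Real.sin_sq_add_cos_sq x
    apply Complex.ext
    · simp only [add_re, sub_re, smul_re, smul_eq_mul, cis_re, e1, e2, e3, one_re, hs]
      rw [Real.cos_two_mul, Real.cos_sub, Real.cos_add]
      field_simp
      rw [hS]
      linear_combination 2 * Real.sin y * hx1
    · simp only [add_im, sub_im, smul_im, smul_eq_mul, cis_im, e1, e2, e3, one_im, hs]
      rw [Real.sin_two_mul, Real.sin_sub, Real.sin_add]
      field_simp
      rw [hS]
      ring
  rw [key]
  have h4 : s / S ≤ 1 := by rw [div_le_one hS0]; exact h2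
  exact convex_regularPolygon n (cis_mem hn p) (cis_mem hn (q - p)) (by linarith)
    (by positivity) (by ring)

lemma fourth_mem (hn : 3 ≤ n) (k : ℤ) {p q : ℤ} (hp : 0 < p) (hp' : p < n) (hq : 0 < q)
    (hq' : q < n) (h : n ≤ 2 * |p - q|) :
    cis n (2 * k + 2 * p) + cis n (2 * k + 2 * q) - cis n (2 * k) ∈ regularPolygon n := by
  rcases le_total q p with hpq | hpq
  · rw [abs_of_nonneg (by omega)] at h
    exact fourth_mem_of_le hn k hq hp' h
  · rw [abs_of_nonpos (by omega)] at h
    rw [add_comm (cis n (2 * k + 2 * p))]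
    exact fourth_mem_of_le hn k hp hq' (by omega)

lemma cos_abs_int (m : ℤ) :
    Real.cos ((|m| : ℤ) * (Real.pi / n)) = Real.cos (m * (Real.pi / n)) := by
  rcases abs_choice m with h | h <;> rw [h]
  push_cast
  rw [neg_mul, Real.cos_neg]

lemma normSq_fourth_lt_one (hn : 3 ≤ n) (k : ℤ) {p q : ℤ} (hp : 0 < p) (hp' : p < n) (hq : 0 < q)
    (hq' : q < n) (h : n < 2 * |p - q|) :
    (cis n (2 * k + 2 * p) + cis n (2 * k + 2 * q) - cis n (2 * k)).re ^ 2 +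
      (cis n (2 * k + 2 * p) + cis n (2 * k + 2 * q) - cis n (2 * k)).im ^ 2 < 1 := by
  rw [normSq_fourth, ← cos_abs_int]
  have h1 := cos_int_neg hn h (by rw [abs_le]; omega)
  have h2 := mul_pos (sin_int_pos hn hp hp') (sin_int_pos hn hq hq')
  nlinarith

/-- The inscribed angle at the middle corner is `|p - q| * π / n`. If it is acute, `normSq_fourth`
puts the fourth corner outside the unit disc. -/
lemma le_of_fourth_mem (hn : 3 ≤ n) (k : ℤ) {p q : ℤ} (hp : 0 < p) (hp' : p < n) (hq : 0 < q)
    (hq' : q < n)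
    (h : cis n (2 * k + 2 * p) + cis n (2 * k + 2 * q) - cis n (2 * k) ∈ regularPolygon n) :
    n ≤ 2 * |p - q| := by
  have h0 := normSq_le h
  rw [normSq_fourth, ← cos_abs_int] at h0
  by_contra hlt
  have h1 := cos_int_pos hn (abs_nonneg (p - q)) (not_le.mp hlt)
  have h2 := mul_pos (sin_int_pos hn hp hp') (sin_int_pos hn hq hq')
  nlinarith

lemma eq_of_fourth_vertex (hn : 3 ≤ n) (k : ℤ) {p q : ℤ} (hp : 0 < p) (hp' : p < n) (hq : 0 < q)
    (hq' : q < n) (h : cis n (2 * k + 2 * p) + cis n (2 * k + 2 * q) - cis n (2 * k) ∈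
      polygonVertices n) : n = 2 * |p - q| := by
  refine le_antisymm (le_of_fourth_mem hn k hp hp' hq hq' (polygonVertices_subset hn h)) ?_
  by_contra hlt
  have h1 := normSq_fourth_lt_one hn k hp hp' hq hq' (not_le.mp hlt)
  have h2 := normSq_vertex h
  linarith

lemma planeDet_ne_zero_of_circle {a b c : ℂ} (ha : a.re ^ 2 + a.im ^ 2 = 1)
    (hb : b.re ^ 2 + b.im ^ 2 = 1) (hc : c.re ^ 2 + c.im ^ 2 = 1) (hab : a ≠ b) (hbc : b ≠ c)
    (hac : a ≠ c) : planeDet (a - c) (b - c) ≠ 0 := by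
  intro h
  simp only [planeDet, sub_re, sub_im] at h
  -- Collinearity means `b - c = (l / N) • (a - c)`. A line meets the circle in at most two points:
  -- `l = 0` gives `b = c` and `l = N` gives `b = a`.
  set l := (a.re - c.re) * (b.re - c.re) + (a.im - c.im) * (b.im - c.im) with hl
  set N := (a.re - c.re) ^ 2 + (a.im - c.im) ^ 2 with hN
  have h1 : N * (b.re - c.re) = l * (a.re - c.re) := by
    linear_combination (-(a.im - c.im)) * h
  have h2 : N * (b.im - c.im) = l * (a.im - c.im) := by
    linear_combination (a.re - c.re) * h
  have hN0 : N ≠ 0 := by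
    intro h0
    have h3 : a.re - c.re = 0 := by nlinarith [sq_nonneg (a.re - c.re), sq_nonneg (a.im - c.im)]
    have h4 : a.im - c.im = 0 := by nlinarith [sq_nonneg (a.re - c.re), sq_nonneg (a.im - c.im)]
    exact hac (Complex.ext (by linarith) (by linarith))
  have h5 : l * (l - N) * N = 0 := by
    have e1 : (b.re - c.re) ^ 2 + (b.im - c.im) ^ 2 + 2 * ((b.re - c.re) * c.re +
      (b.im - c.im) * c.im) = 0 := by linear_combination hb - hc
    have e2 : N + 2 * ((a.re - c.re) * c.re + (a.im - c.im) * c.im) = 0 := by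
      rw [hN]; linear_combination ha - hc
    have e3 : (N * (b.re - c.re)) ^ 2 + (N * (b.im - c.im)) ^ 2 + 2 * N * ((N * (b.re - c.re)) * c.re
      + (N * (b.im - c.im)) * c.im) = 0 := by linear_combination N ^ 2 * e1
    rw [h1, h2] at e3
    have e4 : l ^ 2 * N + 2 * N * l * ((a.re - c.re) * c.re + (a.im - c.im) * c.im) = 0 := by
      rw [← e3, hN]; ring
    linear_combination e4 - l * N * e2
  rcases mul_eq_zero.mp h5 with h6 | h6
  · rcases mul_eq_zero.mp h6 with h7 | h7
    · rw [h7, zero_mul] at h1 h2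
      have h8 := (mul_eq_zero.mp h1).resolve_left hN0
      have h9 := (mul_eq_zero.mp h2).resolve_left hN0
      exact hbc (Complex.ext (by linarith) (by linarith))
    · have h8 : l = N := by linarith
      rw [h8] at h1 h2
      have h8 := mul_left_cancel₀ hN0 h1
      have h9 := mul_left_cancel₀ hN0 h2
      exact hab (Complex.ext (by linarith) (by linarith))
  · exact hN0 h6

end geometry

end

/-! ### Chords between open edges: opposite corners and symmetry -/

noncomputable section

open Complex

section edges

variable {n : ℕ}

lemma OpenEdge.add_mul (hn : 3 ≤ n) {t : ℤ} {z : ℂ} (h : OpenEdge n t z) (k : ℤ) :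
    OpenEdge n (t + n * k) z := by
  obtain ⟨a, b, ha, hb, hab, rfl⟩ := h
  refine ⟨a, b, ha, hb, hab, ?_⟩
  rw [show 2 * (t + n * k) = 2 * t + 2 * n * k by ring, cis_add_two_mul (by omega),
    show 2 * t + 2 * n * k + 2 = 2 * t + 2 + 2 * n * k by ring, cis_add_two_mul (by omega)]

lemma cos_add_pi_int (hn : 3 ≤ n) (m : ℤ) :
    Real.cos ((m + n : ℤ) * (Real.pi / n)) = -Real.cos (m * (Real.pi / n)) := by
  simpa using congrArg Complex.re (cis_add_self (n := n) (by omega) m)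

lemma sin_add_pi_int (hn : 3 ≤ n) (m : ℤ) :
    Real.sin ((m + n : ℤ) * (Real.pi / n)) = -Real.sin (m * (Real.pi / n)) := by
  simpa using congrArg Complex.im (cis_add_self (n := n) (by omega) m)

lemma cos_int_le_of_abs_le (hn : 3 ≤ n) {m k : ℤ} (h : |k| ≤ m) (hm : m ≤ n) :
    Real.cos (m * (Real.pi / n)) ≤ Real.cos (k * (Real.pi / n)) := by
  rw [← cos_abs_int k]
  exact cos_reduced_le (by omega) (abs_nonneg k) h hm

/-- By the double angle formula this is `-cos (π/n) ≤ cos (2mπ/n)`, which holds because `2 * m ≤ n -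
1`. -/
lemma half_chord_bound (hn : 3 ≤ n) {m : ℤ} (h0 : 0 < m) (hm : 2 * m < n) :
    1 - Real.cos (Real.pi / n) ≤ 2 * Real.cos (m * (Real.pi / n)) ^ 2 := by
  have h1 := cos_int_le_of_abs_le hn (m := n - 1) (k := 2 * m) (by rw [abs_le]; omega) (by omega)
  have e1 : Real.cos ((n - 1 : ℤ) * (Real.pi / n)) = -Real.cos (Real.pi / n) := by
    have := cos_add_pi_int hn (-1)
    rw [show (-1 + n : ℤ) = n - 1 by ring] at this
    rw [this]
    simp
  have e2 : Real.cos ((2 * m : ℤ) * (Real.pi / n)) = 2 * Real.cos (m * (Real.pi / n)) ^ 2 - 1 := by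
    rw [← Real.cos_two_mul]; congr 1; push_cast; ring
  linarith

/-- Two points of the polygon with the same midpoint as a chord between vertices: the point on
the side of the chord not containing the centre is not balanced by a point of an open edge. -/
lemma opposite_aux (hn : 3 ≤ n) {p m t : ℤ} (hm0 : 0 < m) (hm : 2 * m < n) {b d : ℂ}
    (hb : b.re ^ 2 + b.im ^ 2 < 1) (hd : OpenEdge n t d)
    (hsum : cis n (2 * p) + cis n (2 * p + 2 * m) = b + d)
    (hX : Real.cos (m * (Real.pi / n)) < proj n (2 * p + m) b) : False := by
  have hh := cos_int_pos hn hm0.le hm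
  have hσ := sin_int_pos hn hm0 (by omega)
  have hbound := half_chord_bound hn hm0 hm
  have hsc := Real.sin_sq_add_cos_sq (m * (Real.pi / n))
  have hproj (s : ℤ) : proj n s b + proj n s d =
      Real.cos ((2 * p - s : ℤ) * (Real.pi / n)) +
      Real.cos ((2 * p + 2 * m - s : ℤ) * (Real.pi / n)) := by
    rw [← proj_add, ← hsum, proj_add, proj_cis, proj_cis]
  have hperp : perp n (2 * p + m) b + perp n (2 * p + m) d = 0 := by
    rw [← perp_add, ← hsum, perp_add, perp_cis, perp_cis,
      show 2 * p - (2 * p + m) = -m by ring, show 2 * p + 2 * m - (2 * p + m) = m by ring]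
    simp
  have hXd := hproj (2 * p + m)
  rw [show 2 * p - (2 * p + m) = -m by ring, show 2 * p + 2 * m - (2 * p + m) = m by ring] at hXd
  simp only [Int.cast_neg, neg_mul, Real.cos_neg] at hXd
  have hYd : perp n (2 * p + m) d ^ 2 < Real.sin (m * (Real.pi / n)) ^ 2 := by
    have h1 := proj_sq_add_perp_sq (n := n) (2 * p + m) b
    rw [show perp n (2 * p + m) d = -perp n (2 * p + m) b by linarith]
    nlinarith
  obtain ⟨hY1, hY2⟩ := abs_lt_of_sq_lt_sq' hYd hσ.le
  obtain ⟨j, hj0, hjn, hd⟩ : ∃ j : ℤ, 0 ≤ j ∧ j < n ∧ OpenEdge n (p + j) d := by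
    have hn' : (0 : ℤ) < n := by omega
    refine ⟨(t - p) % n, Int.emod_nonneg _ hn'.ne', Int.emod_lt_of_pos _ hn', ?_⟩
    have := Int.emod_add_mul_ediv (t - p) n
    convert hd.add_mul hn (-((t - p) / n)) using 1
    linarith
  have hr := hd.proj_eq
  obtain ⟨α, β, hα, hβ, hαβ, hdeq⟩ := hd
  have e1 : 2 * (p + j) - (2 * p + m) = 2 * j - m := by ring
  have e2 : 2 * (p + j) + 2 - (2 * p + m) = 2 * j + 2 - m := by ring
  have hXeq : proj n (2 * p + m) d = α * Real.cos ((2 * j - m : ℤ) * (Real.pi / n)) +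
      β * Real.cos ((2 * j + 2 - m : ℤ) * (Real.pi / n)) := by
    rw [hdeq, proj_add, proj_smul, proj_smul, proj_cis, proj_cis, e1, e2]
  have hYeq : perp n (2 * p + m) d = α * Real.sin ((2 * j - m : ℤ) * (Real.pi / n)) +
      β * Real.sin ((2 * j + 2 - m : ℤ) * (Real.pi / n)) := by
    rw [hdeq, perp_add, perp_smul, perp_smul, perp_cis, perp_cis, e1, e2]
  have hβ' : β = 1 - α := by linarith
  -- In coordinates along and across the bisector of the chord, `d` lies strictly below the chord
  -- and strictly between the perpendiculars through its ends. Edges with `j < m` lie on or above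
  -- the chord, and the two lateral ranges of `j` lie outside the strip.
  rcases lt_or_ge j m with hjm | hjm
  · have c1 := cos_int_le_of_abs_le hn (m := m) (k := 2 * j - m) (by rw [abs_le]; omega) (by omega)
    have c2 := cos_int_le_of_abs_le hn (m := m) (k := 2 * j + 2 - m) (by rw [abs_le]; omega)
      (by omega)
    nlinarith
  · rcases le_or_gt (2 * j + 2) n with h1 | h1
    · have c1 := sin_int_le hn hm0.le (k := 2 * j - m) (by omega) (by omega)
      have c2 := sin_int_le hn hm0.le (k := 2 * j + 2 - m) (by omega) (by omega)
      nlinarith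
    · rcases le_or_gt (n + 2 * m) (2 * j) with h2 | h2
      · have c1 := sin_int_le hn hm0.le (k := 2 * j - m - n) (by omega) (by omega)
        have c2 := sin_int_le hn hm0.le (k := 2 * j + 2 - m - n) (by omega) (by omega)
        have e3 := sin_add_pi_int hn (2 * j - m - n)
        have e4 := sin_add_pi_int hn (2 * j + 2 - m - n)
        rw [sub_add_cancel] at e3 e4
        nlinarith
      -- The remaining edges lie opposite the chord. Projecting the balance relation to the edge
      -- normal and applying `half_chord_bound` gives projection at most `-1` for `b`, outside the
      -- open disc.
      · have c1 := cos_int_le_of_abs_le hn (m := m) (k := 2 * j + 1 - m - n)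
          (by rw [abs_le]; omega) (by omega)
        have hs := hproj (2 * (p + j) + 1)
        have e3 : Real.cos ((2 * p - (2 * (p + j) + 1) : ℤ) * (Real.pi / n)) +
            Real.cos ((2 * p + 2 * m - (2 * (p + j) + 1) : ℤ) * (Real.pi / n)) =
            2 * Real.cos (m * (Real.pi / n)) * Real.cos ((2 * j + 1 - m : ℤ) * (Real.pi / n)) := by
          have a1 : ((2 * p - (2 * (p + j) + 1) : ℤ) : ℝ) * (Real.pi / n) =
            -(m * (Real.pi / n)) - (2 * j + 1 - m : ℤ) * (Real.pi / n) := by push_cast; ring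
          have a2 : ((2 * p + 2 * m - (2 * (p + j) + 1) : ℤ) : ℝ) * (Real.pi / n) =
            m * (Real.pi / n) - (2 * j + 1 - m : ℤ) * (Real.pi / n) := by push_cast; ring
          rw [a1, a2, Real.cos_sub, Real.cos_sub, Real.cos_neg, Real.sin_neg]
          ring
        have e4 := cos_add_pi_int hn (2 * j + 1 - m - n)
        rw [sub_add_cancel] at e4
        rw [e3, e4, hr] at hs
        have hsq := proj_sq_add_perp_sq (n := n) (2 * (p + j) + 1) b
        have hb1 : -1 < proj n (2 * (p + j) + 1) b := by
          nlinarith [sq_nonneg (perp n (2 * (p + j) + 1) b)]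
        nlinarith

/-- A chord between two vertices and a chord between two non-parallel open edges do not have a
common midpoint unless they are collinear. -/
lemma opposite_false (hn : 3 ≤ n) {a b c d : ℂ} {s t : ℤ} (ha : a ∈ polygonVertices n)
    (hc : c ∈ polygonVertices n) (hb : OpenEdge n s b) (hd : OpenEdge n t d)
    (hst : ¬ (n : ℤ) ∣ 2 * (s - t)) (hsum : a + c = b + d)
    (hdet : planeDet (a - c) (b - d) ≠ 0) : False := by
  have core : ∀ p m : ℤ, 0 < m → 2 * m < n → ∀ a c, a = cis n (2 * p) →
      c = cis n (2 * p + 2 * m) → a + c = b + d → planeDet (a - c) (b - d) ≠ 0 → False := by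
    rintro p m hm0 hm a c rfl rfl hsum hdet
    have hX : proj n (2 * p + m) b + proj n (2 * p + m) d = 2 * Real.cos (m * (Real.pi / n)) := by
      rw [← proj_add, ← hsum, proj_add, proj_cis, proj_cis,
        show 2 * p - (2 * p + m) = -m by ring, show 2 * p + 2 * m - (2 * p + m) = m by ring]
      simp only [Int.cast_neg, neg_mul, Real.cos_neg]
      ring
    rcases lt_trichotomy (Real.cos (m * (Real.pi / n))) (proj n (2 * p + m) b) with h | h | h
    · exact opposite_aux hn hm0 hm (hb.normSq_lt hn) hd hsum h
    -- Here both `b` and `d` lie on the line of the chord, so the parallelogram is degenerate.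
    · apply hdet
      rw [planeDet_eq (n := n) (2 * p + m), proj_sub, proj_sub, proj_cis, proj_cis,
        show 2 * p - (2 * p + m) = -m by ring, show 2 * p + 2 * m - (2 * p + m) = m by ring]
      simp only [Int.cast_neg, neg_mul, Real.cos_neg]
      rw [show proj n (2 * p + m) d = proj n (2 * p + m) b by linarith]
      ring
    · exact opposite_aux hn hm0 hm (hd.normSq_lt hn) hb (hsum.trans (add_comm _ _)) (by linarith)
  obtain ⟨p, hp⟩ := ha
  obtain ⟨q, hq⟩ := hc
  have hn' : (0 : ℤ) < n := by omega
  have h0 := Int.emod_nonneg (q - p) hn'.ne'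
  have h1 := Int.emod_lt_of_pos (q - p) hn'
  have h2 := Int.emod_add_mul_ediv (q - p) n
  set m := (q - p) % n
  have hq' : c = cis n (2 * p + 2 * m) := by
    rw [hq, cis_eq_iff (by omega)]
    exact ⟨(q - p) / n, by linarith⟩
  rcases h0.eq_or_lt with h0 | h0
  · apply hdet
    rw [hp, hq', ← h0]
    simp [planeDet]
  rcases lt_trichotomy (2 * m) n with h3 | h3 | h3
  · exact core p m h0 h3 a c hp hq' hsum hdet
  -- The chord is a diameter, so `b = -d` and the two edges would be parallel.
  · have hac : a + c = 0 := by
      rw [hp, hq', h3, cis_add_self (by omega)]; ring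
    have hdb : b = -d := by rw [eq_neg_iff_add_eq_zero, ← hsum, hac]
    have h4 : proj n (2 * (s + m) + 1) d = Real.cos (Real.pi / n) := by
      rw [show 2 * (s + m) + 1 = 2 * s + 1 + n by linarith, proj_add_self (by omega), ← proj_neg,
        ← hdb, hb.proj_eq]
    obtain ⟨k, hk⟩ := hd.dvd_of_proj_eq hn h4
    exact hst ⟨-2 * k - 1, by linarith⟩
  · refine core (p + m) (n - m) (by omega) (by omega) c a ?_ ?_ ((add_comm _ _).trans hsum) ?_
    · rw [hq']; congr 1; ring
    · rw [hp, cis_eq_iff (by omega)]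
      exact ⟨-1, by ring⟩
    · intro h
      apply hdet
      simp only [planeDet, sub_re, sub_im] at h ⊢
      linarith

/-- The reflection that exchanges the vertices `cis n (2 * p)` and `cis n (2 * q)` preserves the
polygon. -/
lemma reflection_mem (hn : 3 ≤ n) {p q : ℤ} {z w : ℂ} (hz : z ∈ regularPolygon n)
    (h1 : proj n (p + q) w = proj n (p + q) z) (h2 : perp n (p + q) w = -perp n (p + q) z) :
    w ∈ regularPolygon n := by
  rw [mem_regularPolygon_iff hn]
  intro t
  have := proj_le hn (p + q - t - 1) hz
  rw [proj_eq_proj_perp (p + q)] at this ⊢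
  rw [h1, h2]
  rw [show 2 * (p + q - t - 1) + 1 - (p + q) = -(2 * t + 1 - (p + q)) by ring] at this
  simp only [Int.cast_neg, neg_mul, Real.cos_neg, Real.sin_neg] at this
  linarith

/-- Reflection in the axis of direction `p + q` sends the normal index `u` to `2 * (p + q) - u`,
hence the edge `t` to the edge `p + q - t - 1`. -/
lemma reflection_proj {p q t : ℤ} {z w : ℂ}
    (h1 : proj n (p + q) w = proj n (p + q) z) (h2 : perp n (p + q) w = -perp n (p + q) z) :
    proj n (2 * (p + q - t - 1) + 1) w = proj n (2 * t + 1) z := by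
  rw [proj_eq_proj_perp (p + q), proj_eq_proj_perp (p + q) (2 * t + 1), h1, h2,
    show 2 * (p + q - t - 1) + 1 - (p + q) = -(2 * t + 1 - (p + q)) by ring]
  simp only [Int.cast_neg, neg_mul, Real.cos_neg, Real.sin_neg]
  ring

lemma exists_reflection (s : ℤ) (z : ℂ) :
    ∃ w, proj n s w = proj n s z ∧ perp n s w = -perp n s z := by
  have h := cis_sq_add_sq (n := n) s
  refine ⟨⟨proj n s z * Real.cos (s * (Real.pi / n)) + perp n s z * Real.sin (s * (Real.pi / n)),
    proj n s z * Real.sin (s * (Real.pi / n)) - perp n s z * Real.cos (s * (Real.pi / n))⟩, ?_, ?_⟩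
  · conv_lhs => rw [proj]
    linear_combination proj n s z * h
  · conv_lhs => rw [perp]
    linear_combination (-perp n s z) * h

/-- If a chord of the polygon between non-parallel open edges is a translate of a chord between
two vertices then it is placed symmetrically with respect to the bisector of the latter. -/
lemma adjacent_symm (hn : 3 ≤ n) {p q s t : ℤ} {c d : ℂ} (hpq : ¬ (n : ℤ) ∣ p - q)
    (hc : OpenEdge n s c) (hd : OpenEdge n t d) (hst : ¬ (n : ℤ) ∣ 2 * (s - t))
    (hsum : cis n (2 * p) + c = cis n (2 * q) + d) :
    perp n (p + q) d = Real.sin ((p - q : ℤ) * (Real.pi / n)) ∧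
      Real.cos ((2 * t + 1 - (p + q) : ℤ) * (Real.pi / n)) ≠ 0 := by
  have hσ : Real.sin ((p - q : ℤ) * (Real.pi / n)) ≠ 0 := fun h => hpq (dvd_of_sin_eq_zero hn h)
  have hX : proj n (p + q) c = proj n (p + q) d := by
    have := congrArg (proj n (p + q)) hsum
    rw [proj_add, proj_add, proj_cis, proj_cis, show 2 * p - (p + q) = p - q by ring,
      show 2 * q - (p + q) = -(p - q) by ring] at this
    simp only [Int.cast_neg, neg_mul, Real.cos_neg] at this
    linarith
  have hY : perp n (p + q) c = perp n (p + q) d - 2 * Real.sin ((p - q : ℤ) * (Real.pi / n)) := by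
    have := congrArg (perp n (p + q)) hsum
    rw [perp_add, perp_add, perp_cis, perp_cis, show 2 * p - (p + q) = p - q by ring,
      show 2 * q - (p + q) = -(p - q) by ring] at this
    simp only [Int.cast_neg, neg_mul, Real.sin_neg] at this
    linarith
  obtain ⟨c', hc1, hc2⟩ := exists_reflection (n := n) (p + q) c
  obtain ⟨d', hd1, hd2⟩ := exists_reflection (n := n) (p + q) d
  have hcQ := hc.mem hn
  have hdQ := hd.mem hn
  have hcQ' := reflection_mem hn hcQ hc1 hc2
  have hdQ' := reflection_mem hn hdQ hd1 hd2
  -- At the height of `z`, a mirror pair in the polygon cannot be wider than `z` is far from the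
  -- axis: the inequality of edge `u` at both points bounds `|κ * perp w|` by `κ * perp z`.
  have dom {u : ℤ} {z w w' : ℂ} (hz : proj n (2 * u + 1) z = Real.cos (Real.pi / n))
      (hw : w ∈ regularPolygon n) (hw' : w' ∈ regularPolygon n)
      (e1 : proj n (p + q) w = proj n (p + q) z) (e2 : proj n (p + q) w' = proj n (p + q) z)
      (e3 : perp n (p + q) w' = -perp n (p + q) w)
      (hκ : Real.sin ((2 * u + 1 - (p + q) : ℤ) * (Real.pi / n)) ≠ 0) :
      perp n (p + q) w ^ 2 ≤ perp n (p + q) z ^ 2 := by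
    have h1 := proj_le hn u hw
    have h2 := proj_le hn u hw'
    rw [← hz, proj_eq_proj_perp (p + q), proj_eq_proj_perp (p + q) _ z] at h1 h2
    rw [e1] at h1
    rw [e2, e3] at h2
    set κ := Real.sin ((2 * u + 1 - (p + q) : ℤ) * (Real.pi / n))
    have h3 : (κ * perp n (p + q) w) ^ 2 ≤ (κ * perp n (p + q) z) ^ 2 :=
      sq_le_sq' (by linarith) (by linarith)
    have h4 : 0 < κ ^ 2 := by positivity
    rw [mul_pow, mul_pow] at h3
    exact le_of_mul_le_mul_left h3 h4
  have hst1 : ¬ (n : ℤ) ∣ s - t := fun h => hst (h.mul_left 2)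
  have hst2 : ¬ (n : ℤ) ∣ t - s := fun h => hst1 (by rw [← neg_sub]; exact h.neg_right)
  have hκt : Real.sin ((2 * t + 1 - (p + q) : ℤ) * (Real.pi / n)) ≠ 0 := by
    intro h
    apply hst1
    apply hc.dvd_of_proj_eq hn
    rw [← hd.proj_eq, proj_eq_proj_perp (p + q), proj_eq_proj_perp (p + q) _ d, h, hX]
    ring
  have hκs : Real.sin ((2 * s + 1 - (p + q) : ℤ) * (Real.pi / n)) ≠ 0 := by
    intro h
    apply hst2
    apply hd.dvd_of_proj_eq hn
    rw [← hc.proj_eq, proj_eq_proj_perp (p + q), proj_eq_proj_perp (p + q) _ c, h, hX]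
    ring
  have d1 := dom hd.proj_eq hcQ hcQ' hX (hc1.trans hX) hc2 hκt
  have d2 := dom hc.proj_eq hdQ hdQ' hX.symm (hd1.trans hX.symm) hd2 hκs
  -- `c` and `d` are equally far from the axis, and their offsets differ by twice the nonzero sine,
  -- so they are mirror images.
  have hYd : perp n (p + q) d = Real.sin ((p - q : ℤ) * (Real.pi / n)) := by
    have h1 : perp n (p + q) c ^ 2 = perp n (p + q) d ^ 2 := le_antisymm d1 d2
    rw [hY] at h1
    apply mul_left_cancel₀ hσ
    linarith
  refine ⟨hYd, fun hcos => hst ?_⟩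
  have hrefl : perp n (p + q) c = -perp n (p + q) d := by rw [hY, hYd]; ring
  -- Thus `c` lies on the reflected edge, which would be parallel to edge `t` if the cosine
  -- vanished.
  have h1 : proj n (2 * (p + q - t - 1) + 1) c = Real.cos (Real.pi / n) := by
    rw [reflection_proj hX hrefl, hd.proj_eq]
  obtain ⟨k, hk⟩ := hc.dvd_of_proj_eq hn h1
  obtain ⟨l, hl⟩ := dvd_of_cos_eq_zero hn hcos
  exact ⟨2 * k - l, by linarith⟩

end edges

end

/-! ### Two adjacent corners at polygon vertices -/

noncomputable section

open Complex

section adjacent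

variable {n : ℕ}

/-- The supporting line of the edge at `d` is transverse to the line through `z`, `d`, `w`, so it
would leave `z` or `w` outside the polygon. -/
lemma strictly_between_false (hn : 3 ≤ n) {s t : ℤ} {z w d : ℂ} (hz : z ∈ regularPolygon n)
    (hw : w ∈ regularPolygon n) (hd : OpenEdge n t d) (h1 : perp n s z = perp n s d)
    (h2 : perp n s w = perp n s d)
    (hlt : (proj n s z - proj n s d) * (proj n s w - proj n s d) < 0)
    (hcos : Real.cos ((2 * t + 1 - s : ℤ) * (Real.pi / n)) ≠ 0) : False := by
  have e1 := proj_le hn t hz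
  have e2 := proj_le hn t hw
  rw [← hd.proj_eq, proj_eq_proj_perp s, proj_eq_proj_perp s _ d] at e1 e2
  rw [h1] at e1
  rw [h2] at e2
  set κ := Real.cos ((2 * t + 1 - s : ℤ) * (Real.pi / n))
  have h3 : 0 ≤ ((proj n s z - proj n s d) * κ) * ((proj n s w - proj n s d) * κ) :=
    mul_nonneg_of_nonpos_of_nonpos (by linarith) (by linarith)
  have h4 : 0 < κ ^ 2 := by positivity
  nlinarith

lemma proj_bisector_left (p q : ℤ) :
    proj n (p + q) (cis n (2 * p)) = Real.cos ((p - q : ℤ) * (Real.pi / n)) := by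
  rw [proj_cis]; congr 3; ring

lemma perp_bisector_left (p q : ℤ) :
    perp n (p + q) (cis n (2 * p)) = Real.sin ((p - q : ℤ) * (Real.pi / n)) := by
  rw [perp_cis]; congr 3; ring

lemma proj_bisector_right (p q : ℤ) :
    proj n (p + q) (cis n (2 * q)) = Real.cos ((p - q : ℤ) * (Real.pi / n)) := by
  rw [proj_cis, show 2 * q - (p + q) = -(p - q) by ring]
  simp only [Int.cast_neg, neg_mul, Real.cos_neg]

lemma perp_bisector_right (p q : ℤ) :
    perp n (p + q) (cis n (2 * q)) = -Real.sin ((p - q : ℤ) * (Real.pi / n)) := by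
  rw [perp_cis, show 2 * q - (p + q) = -(p - q) by ring]
  simp only [Int.cast_neg, neg_mul, Real.sin_neg]

lemma proj_sq_lt_of_perp_eq (hn : 3 ≤ n) {p q t : ℤ} {d : ℂ} (hd : OpenEdge n t d)
    (hY : perp n (p + q) d = Real.sin ((p - q : ℤ) * (Real.pi / n))) :
    proj n (p + q) d ^ 2 < Real.cos ((p - q : ℤ) * (Real.pi / n)) ^ 2 := by
  have h1 := hd.normSq_lt hn
  rw [← proj_sq_add_perp_sq (n := n) (p + q), hY] at h1
  have := Real.sin_sq_add_cos_sq ((p - q : ℤ) * (Real.pi / n))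
  linarith

/-- For even `n` the antipode of `cis n (2 * q)` is a vertex. It and `cis n (2 * p)` lie on the
parallel to the bisector through `d`, at opposite heights, with `d` strictly between them. -/
lemma adjacent_even_false (hn : 3 ≤ n) (heven : Even n) {p q s t : ℤ} {c d : ℂ}
    (hpq : ¬ (n : ℤ) ∣ p - q) (hc : OpenEdge n s c) (hd : OpenEdge n t d)
    (hst : ¬ (n : ℤ) ∣ 2 * (s - t)) (hsum : cis n (2 * p) + c = cis n (2 * q) + d) : False := by
  obtain ⟨hY, hcos⟩ := adjacent_symm hn hpq hc hd hst hsum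
  obtain ⟨m, hm⟩ := heven
  have hX := proj_sq_lt_of_perp_eq hn hd hY
  have e : cis n (2 * (q + m)) = (-1 : ℝ) • cis n (2 * q) := by
    rw [show 2 * (q + m) = 2 * q + (n : ℤ) by rw [hm]; push_cast; ring, cis_add_self (by omega)]
    simp
  refine strictly_between_false hn (cis_mem hn p) (cis_mem hn (q + m)) hd (s := p + q) ?_ ?_ ?_ hcos
  · rw [perp_bisector_left, hY]
  · rw [e, perp_smul, perp_bisector_right, hY]; ring
  · rw [e, proj_smul, proj_bisector_left, proj_bisector_right]
    nlinarith

/-- The signed distance by which the chord between the vertices `cis n (2 * p)` and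
`cis n (2 * q)` has to be translated along its bisector to become a chord between two edges. -/
def chordShift (n : ℕ) (p q : ℤ) : ℝ :=
  (Real.sin ((p - q : ℤ) * (Real.pi / n)) ^ 2 - Real.cos (Real.pi / n)) /
    Real.cos ((p - q : ℤ) * (Real.pi / n)) - Real.cos ((p - q : ℤ) * (Real.pi / n))

lemma isCoprime_two_of_odd (hodd : Odd n) : IsCoprime (n : ℤ) 2 := by
  rw [Int.isCoprime_iff_gcd_eq_one]
  simpa [Int.gcd] using hodd.coprime_two_right

lemma cos_sub_ne_zero (hn : 3 ≤ n) (hodd : Odd n) {p q : ℤ} (hpq : ¬ (n : ℤ) ∣ p - q) :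
    Real.cos ((p - q : ℤ) * (Real.pi / n)) ≠ 0 := by
  intro h
  have h1 := dvd_of_cos_eq_zero hn h
  exact hpq ((isCoprime_two_of_odd hodd).dvd_of_dvd_mul_left h1)

/-- The translate of the vertex `cis n (2 * p)` by `chordShift`. -/
def chordEnd (n : ℕ) (p q : ℤ) : ℂ := cis n (2 * p) + chordShift n p q • cis n (p + q)

lemma perp_chordEnd (p q : ℤ) :
    perp n (p + q) (chordEnd n p q) = Real.sin ((p - q : ℤ) * (Real.pi / n)) := by
  rw [chordEnd, perp_add, perp_smul, perp_bisector_left, perp_cis]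
  simp

lemma proj_chordEnd_mul (hn : 3 ≤ n) (hodd : Odd n) {p q : ℤ} (hpq : ¬ (n : ℤ) ∣ p - q) :
    proj n (p + q) (chordEnd n p q) * Real.cos ((p - q : ℤ) * (Real.pi / n)) =
      Real.sin ((p - q : ℤ) * (Real.pi / n)) ^ 2 - Real.cos (Real.pi / n) := by
  have := cos_sub_ne_zero hn hodd hpq
  rw [chordEnd, proj_add, proj_smul, proj_bisector_left, proj_cis, chordShift]
  simp only [sub_self, Int.cast_zero, zero_mul, Real.cos_zero, mul_one]
  rw [add_sub_cancel, div_mul_cancel₀ _ this]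

/-- For odd `n` the edge `q + m` is the one opposite the vertex `cis n (2 * q)`; its outer normal is
the negative of that vertex. -/
lemma proj_antipode (hn : 3 ≤ n) {m : ℕ} (hm : n = 2 * m + 1) (p q : ℤ) (z : ℂ) :
    proj n (2 * (q + m) + 1) z =
      -(proj n (p + q) z * Real.cos ((p - q : ℤ) * (Real.pi / n))) +
        perp n (p + q) z * Real.sin ((p - q : ℤ) * (Real.pi / n)) := by
  rw [show 2 * (q + m) + 1 = 2 * q + (n : ℤ) by rw [hm]; push_cast; ring,
    proj_add_self (by omega), proj_eq_proj_perp (p + q),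
    show 2 * q - (p + q) = -(p - q) by ring]
  simp only [Int.cast_neg, neg_mul, Real.sin_neg, Real.cos_neg]
  ring

/-- This equation is the origin of `chordShift`: it solves for the translation that puts the end of
the chord on the line of the edge opposite `cis n (2 * q)`. -/
lemma proj_chordEnd (hn : 3 ≤ n) {m : ℕ} (hm : n = 2 * m + 1) {p q : ℤ}
    (hpq : ¬ (n : ℤ) ∣ p - q) :
    proj n (2 * (q + m) + 1) (chordEnd n p q) = Real.cos (Real.pi / n) := by
  rw [proj_antipode hn hm p, proj_chordEnd_mul hn ⟨m, hm⟩ hpq, perp_chordEnd]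
  ring

lemma chordEnd_openEdge (hn : 3 ≤ n) {m : ℕ} (hm : n = 2 * m + 1) {p q : ℤ}
    (hpq : ¬ (n : ℤ) ∣ p - q) (h1 : ¬ (n : ℤ) ∣ p - (q + m)) (h2 : ¬ (n : ℤ) ∣ p - (q + m) - 1) :
    OpenEdge n (q + m) (chordEnd n p q) := by
  apply openEdge_of_normSq_lt hn (proj_chordEnd hn hm hpq)
  have ha := proj_le hn (q + m) (cis_mem hn p)
  have ha' : proj n (2 * (q + m) + 1) (cis n (2 * p)) ≠ Real.cos (Real.pi / n) := by
    intro h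
    rw [proj_cis, show 2 * p - (2 * (q + m) + 1) = 2 * (p - (q + m) - 1) + 1 by ring] at h
    rcases odd_cos_eq (by omega) _ h with h | h
    · exact h2 h
    · exact h1 (by simpa using h)
  have ha := lt_of_le_of_ne ha ha'
  rw [proj_antipode hn hm p, proj_bisector_left, perp_bisector_left] at ha
  have hX := proj_chordEnd_mul hn ⟨m, hm⟩ hpq
  have hsc := Real.sin_sq_add_cos_sq ((p - q : ℤ) * (Real.pi / n))
  have hr := cos_pi_div_lt_one hn
  have hne := cos_sub_ne_zero hn ⟨m, hm⟩ hpq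
  rw [← proj_sq_add_perp_sq (n := n) (p + q), perp_chordEnd]
  set h := Real.cos ((p - q : ℤ) * (Real.pi / n))
  set X := proj n (p + q) (chordEnd n p q)
  -- The upper bound on `X * h` says that `cis n (2 * p)` is strictly inside the opposite edge line;
  -- the lower bound is `cos (π / n) < 1`.
  have h3 : (X * h) ^ 2 < (h ^ 2) ^ 2 := sq_lt_sq' (by linarith) (by linarith)
  have h4 : 0 < h ^ 2 := by positivity
  have h5 : X ^ 2 < h ^ 2 := by
    by_contra hlt
    nlinarith
  linarith

/-- By symmetry `d` lies on the parallel to the bisector through `cis n (2 * p)`. The inequality of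
the edge opposite `cis n (2 * q)` keeps it from passing `chordEnd`, and stopping earlier would put
it strictly between two polygon points. -/
lemma adjacent_odd (hn : 3 ≤ n) {m : ℕ} (hm : n = 2 * m + 1) {p q s t : ℤ} {c d : ℂ}
    (hpq : ¬ (n : ℤ) ∣ p - q) (hc : OpenEdge n s c) (hd : OpenEdge n t d)
    (hst : ¬ (n : ℤ) ∣ 2 * (s - t)) (hsum : cis n (2 * p) + c = cis n (2 * q) + d) :
    d = chordEnd n p q ∧ ¬ (n : ℤ) ∣ p - (q + m) ∧ ¬ (n : ℤ) ∣ p - (q + m) - 1 := by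
  obtain ⟨hY, hcos⟩ := adjacent_symm hn hpq hc hd hst hsum
  have hX := proj_sq_lt_of_perp_eq hn hd hY
  have hD := proj_chordEnd_mul hn ⟨m, hm⟩ hpq
  have hne := cos_sub_ne_zero hn ⟨m, hm⟩ hpq
  have hdle := proj_le hn (q + m) (hd.mem hn)
  rw [proj_antipode hn hm p, hY] at hdle
  have hsc := Real.sin_sq_add_cos_sq ((p - q : ℤ) * (Real.pi / n))
  have hr := cos_pi_div_lt_one hn
  have hlt : proj n (p + q) d * Real.cos ((p - q : ℤ) * (Real.pi / n)) <
      Real.cos ((p - q : ℤ) * (Real.pi / n)) ^ 2 := by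
    have h1 : 0 < Real.cos ((p - q : ℤ) * (Real.pi / n)) ^ 2 := by positivity
    nlinarith [sq_nonneg (proj n (p + q) d - Real.cos ((p - q : ℤ) * (Real.pi / n)))]
  have hvert (h : proj n (2 * (q + m) + 1) (cis n (2 * p)) = Real.cos (Real.pi / n)) : False := by
    rw [proj_antipode hn hm p, proj_bisector_left, perp_bisector_left] at h
    nlinarith
  have h1 : ¬ (n : ℤ) ∣ p - (q + m) := by
    rintro ⟨k, hk⟩
    apply hvert
    rw [show 2 * p = 2 * (q + m) + 2 * n * k by linarith, cis_add_two_mul (by omega), proj_cis,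
      show 2 * (q + m) - (2 * (q + m) + 1) = -(1 : ℤ) by ring]
    simp
  have h2 : ¬ (n : ℤ) ∣ p - (q + m) - 1 := by
    rintro ⟨k, hk⟩
    apply hvert
    rw [show 2 * p = 2 * (q + m) + 2 + 2 * n * k by linarith, cis_add_two_mul (by omega), proj_cis,
      show 2 * (q + m) + 2 - (2 * (q + m) + 1) = (1 : ℤ) by ring]
    simp
  refine ⟨?_, h1, h2⟩
  refine ext_proj_perp (n := n) (p + q) ?_ (by rw [hY, perp_chordEnd])
  have hle : proj n (p + q) (chordEnd n p q) * Real.cos ((p - q : ℤ) * (Real.pi / n)) ≤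
      proj n (p + q) d * Real.cos ((p - q : ℤ) * (Real.pi / n)) := by linarith
  rcases hle.eq_or_lt with h | h
  · exact (mul_right_cancel₀ hne h).symm
  · exfalso
    refine strictly_between_false hn (cis_mem hn p) ((chordEnd_openEdge hn hm hpq h1 h2).mem hn) hd
      (s := p + q) ?_ ?_ ?_ hcos
    · rw [perp_bisector_left, hY]
    · rw [perp_chordEnd, hY]
    · rw [proj_bisector_left]
      set h' := Real.cos ((p - q : ℤ) * (Real.pi / n))
      have h3 : ((h' - proj n (p + q) d) * h') *
          ((proj n (p + q) (chordEnd n p q) - proj n (p + q) d) * h') < 0 :=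
        mul_neg_of_pos_of_neg (by linarith) (by linarith)
      have h4 : 0 < h' ^ 2 := by positivity
      by_contra hcon
      nlinarith

/-- The determinant is four times the shift times half the chord length, up to sign; a zero shift
would make `chordEnd` a vertex. -/
lemma planeDet_chord_ne_zero (hn : 3 ≤ n) {p q : ℤ} (hpq : ¬ (n : ℤ) ∣ p - q)
    (h : chordEnd n p q ∉ polygonVertices n) :
    planeDet (cis n (2 * p) - (cis n (2 * q) + chordShift n p q • cis n (p + q)))
      (cis n (2 * q) - chordEnd n p q) ≠ 0 := by
  have hσ : Real.sin ((p - q : ℤ) * (Real.pi / n)) ≠ 0 := fun h => hpq (dvd_of_sin_eq_zero hn h)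
  have hs : chordShift n p q ≠ 0 := fun h0 => h ⟨p, by simp [chordEnd, h0]⟩
  have e : planeDet (cis n (2 * p) - (cis n (2 * q) + chordShift n p q • cis n (p + q)))
      (cis n (2 * q) - chordEnd n p q) =
      4 * chordShift n p q * Real.sin ((p - q : ℤ) * (Real.pi / n)) := by
    have hperp (z w : ℂ) : perp n (p + q) (z - w) = perp n (p + q) z - perp n (p + q) w := by
      simp only [perp, sub_re, sub_im]; ring
    rw [planeDet_eq (n := n) (p + q), hperp, hperp, perp_chordEnd, chordEnd]
    simp only [proj_sub, proj_add, perp_add, proj_smul, perp_smul, proj_bisector_left,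
      proj_bisector_right, perp_bisector_left, perp_bisector_right]
    rw [proj_cis, perp_cis]
    simp only [sub_self, Int.cast_zero, zero_mul, Real.cos_zero, Real.sin_zero]
    ring
  rw [e]
  positivity

/-- The point opposite to `chordEnd` on the translated chord. -/
lemma chordEnd_symm_openEdge (hn : 3 ≤ n) {m : ℕ} (hm : n = 2 * m + 1) {p q : ℤ}
    (hpq : ¬ (n : ℤ) ∣ p - q) (h1 : ¬ (n : ℤ) ∣ p - (q + m)) (h2 : ¬ (n : ℤ) ∣ p - (q + m) - 1) :
    OpenEdge n (p - m - 1) (cis n (2 * q) + chordShift n p q • cis n (p + q)) := by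
  have e1 : proj n (p + q) (cis n (2 * q) + chordShift n p q • cis n (p + q)) =
      proj n (p + q) (chordEnd n p q) := by
    rw [chordEnd, proj_add, proj_add, proj_bisector_left, proj_bisector_right]
  have e2 : perp n (p + q) (cis n (2 * q) + chordShift n p q • cis n (p + q)) =
      -perp n (p + q) (chordEnd n p q) := by
    rw [chordEnd, perp_add, perp_add, perp_bisector_left, perp_bisector_right, perp_smul, perp_cis]
    simp
  have hD := chordEnd_openEdge hn hm hpq h1 h2
  apply openEdge_of_normSq_lt hn
  · have := reflection_proj (t := q + m) e1 e2
    rw [proj_chordEnd hn hm hpq] at this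
    rw [← this]
    congr 2; ring
  · have := hD.normSq_lt hn
    rw [← proj_sq_add_perp_sq (n := n) (p + q)] at this ⊢
    rw [e1, e2, neg_sq]
    exact this

end adjacent

end

/-! ### Sorting by the corners that are vertices, up to cyclic shift -/

noncomputable section

open Complex

section patterns

variable {n : ℕ}

/-- The elements of `vertexTuples` whose entries at exactly the positions in `S` are vertices of
the polygon. -/
def patternTuples (n : ℕ) (S : Finset (Fin 4)) : Set (Fin 4 → ℂ) :=
  {x ∈ vertexTuples n | ∀ i, x i ∈ polygonVertices n ↔ i ∈ S}

/-- The cyclic shift of quadruples. -/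
def tupleShift (k : Fin 4) (x : Fin 4 → ℂ) : Fin 4 → ℂ := fun i => x (i + k)

lemma tupleShift_injective (k : Fin 4) : Function.Injective (tupleShift k) := by
  intro x y h
  funext i
  have := congrFun h (i - k)
  simpa [tupleShift] using this

lemma IsRigid.shift {x : Fin 4 → ℂ} (h : IsRigid n x) (k : Fin 4) : IsRigid n (tupleShift k x) := by
  rcases h with ⟨p, hp⟩ | ⟨p, q, s, t, hpq, hs, ht, hst, hv⟩
  · left
    refine ⟨p - k, fun i hi => hp _ fun h => hi ?_⟩
    rw [← h, add_sub_cancel_right]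
  · right
    refine ⟨p - k, q - k, s, t, fun h => hpq (sub_left_injective h), ?_, ?_, hst,
      fun i hi hi' => hv _ (fun h => hi ?_) (fun h => hi' ?_)⟩
    · simpa [tupleShift] using hs
    · simpa [tupleShift] using ht
    · rw [← h, add_sub_cancel_right]
    · rw [← h, add_sub_cancel_right]

lemma vertexTuples_shift_one {x : Fin 4 → ℂ} (hx : x ∈ vertexTuples n) :
    tupleShift 1 x ∈ vertexTuples n := by
  obtain ⟨h1, h2, h3, h4⟩ := hx
  refine ⟨fun i => h1 _, ?_, h3.shift 1, ?_⟩
  · change x 1 + x 3 = x 2 + x 0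
    rw [← h2, add_comm]
  · change planeDet (x 1 - x 3) (x 2 - x 0) ≠ 0
    intro h
    apply h4
    simp only [planeDet, sub_re, sub_im] at h ⊢
    linarith

lemma vertexTuples_shift {x : Fin 4 → ℂ} (hx : x ∈ vertexTuples n) (k : Fin 4) :
    tupleShift k x ∈ vertexTuples n := by
  have h0 : tupleShift 0 x = x := by funext i; simp [tupleShift]
  have hadd (a b : Fin 4) : tupleShift a (tupleShift b x) = tupleShift (a + b) x := by
    funext i; simp [tupleShift, add_assoc]
  have h1 := vertexTuples_shift_one hx
  have h2 := vertexTuples_shift_one h1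
  have h3 := vertexTuples_shift_one h2
  rw [hadd] at h2
  rw [hadd, hadd] at h3
  fin_cases k
  · exact h0.symm ▸ hx
  · exact h1
  · exact h2
  · exact h3

lemma patternTuples_eq_image {S S' : Finset (Fin 4)} (k : Fin 4) (h : ∀ i, i ∈ S' ↔ i + k ∈ S) :
    patternTuples n S' = tupleShift k '' patternTuples n S := by
  ext x
  constructor
  · rintro ⟨hx, hS⟩
    refine ⟨tupleShift (-k) x, ⟨vertexTuples_shift hx _, fun i => ?_⟩, ?_⟩
    · rw [tupleShift, hS, h, neg_add_cancel_right]
    · funext i; simp [tupleShift]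
  · rintro ⟨y, ⟨hy, hS⟩, rfl⟩
    exact ⟨vertexTuples_shift hy k, fun i => (hS _).trans (h i).symm⟩

lemma planeDet_diagonals {a b c d : ℂ} (h : a + c = b + d) :
    planeDet (a - c) (b - d) = 2 * planeDet (a - c) (b - c) := by
  have hd : d = a + c - b := by rw [h]; ring
  subst hd
  simp only [planeDet, sub_re, sub_im, add_re, add_im]
  ring

lemma distinct_of_planeDet {a b c d : ℂ} (h : a + c = b + d)
    (hdet : planeDet (a - c) (b - d) ≠ 0) : a ≠ b ∧ b ≠ c ∧ a ≠ c := by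
  rw [planeDet_diagonals h] at hdet
  refine ⟨?_, ?_, ?_⟩ <;> rintro rfl <;> apply hdet <;> simp [planeDet]; ring

lemma opposite_pair_false (hn : 3 ≤ n) {x : Fin 4 → ℂ} (hx : x ∈ vertexTuples n) {p : Fin 4}
    {s t : ℤ} (hs : OpenEdge n s (x p)) (ht : OpenEdge n t (x (p + 2)))
    (hst : ¬ (n : ℤ) ∣ 2 * (s - t)) (h1 : x (p + 1) ∈ polygonVertices n)
    (h3 : x (p + 3) ∈ polygonVertices n) : False := by
  obtain ⟨-, hsum, -, hdet⟩ := vertexTuples_shift hx p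
  have e0 : tupleShift p x 0 = x p := by simp [tupleShift]
  have e1 : tupleShift p x 1 = x (p + 1) := by simp [tupleShift, add_comm]
  have e2 : tupleShift p x 2 = x (p + 2) := by simp [tupleShift, add_comm]
  have e3 : tupleShift p x 3 = x (p + 3) := by simp [tupleShift, add_comm]
  rw [e0, e1, e2, e3] at hsum hdet
  refine opposite_false hn h1 h3 hs ht hst hsum.symm fun h => hdet ?_
  simp only [planeDet, sub_re, sub_im] at h ⊢
  linarith

/-- Rigidity allows at most two non-vertex corners, and two opposite ones are excluded by
`opposite_pair_false`. -/
lemma pattern_cases (hn : 3 ≤ n) {S : Finset (Fin 4)} (h : (patternTuples n S).Nonempty) :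
    S.card = 4 ∨ S.card = 3 ∨ ∃ k, S = {k, k + 1} := by
  obtain ⟨x, hx, hS⟩ := h
  have hr := hx.2.2.1
  rcases hr with ⟨p, hp⟩ | ⟨p, q, s, t, hpq, hs, ht, hst, hv⟩
  · have key : ∀ (S : Finset (Fin 4)) (p : Fin 4), (∀ i, i ≠ p → i ∈ S) →
        S.card = 4 ∨ S.card = 3 := by decide
    rcases key S p fun i hi => (hS i).mp (hp i hi) with h | h
    · exact Or.inl h
    · exact Or.inr (Or.inl h)
  · right; right
    have h1 : p ∉ S := fun h => hs.notMem hn ((hS p).mpr h)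
    have h2 : q ∉ S := fun h => ht.notMem hn ((hS q).mpr h)
    have h3 : ∀ i, i ≠ p → i ≠ q → i ∈ S := fun i hi hi' => (hS i).mp (hv i hi hi')
    have key : ∀ (S : Finset (Fin 4)) (p q : Fin 4), p ≠ q → p ∉ S → q ∉ S →
        (∀ i, i ≠ p → i ≠ q → i ∈ S) → (∃ k, S = {k, k + 1}) ∨ q = p + 2 := by decide
    rcases key S p q hpq h1 h2 h3 with h | rfl
    · exact h
    · exfalso
      have key : ∀ p : Fin 4, p + 1 ≠ p ∧ p + 1 ≠ p + 2 ∧ p + 3 ≠ p ∧ p + 3 ≠ p + 2 := by decide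
      obtain ⟨k1, k2, k3, k4⟩ := key p
      exact opposite_pair_false hn hx hs ht hst (hv _ k1 k2) (hv _ k3 k4)

lemma vertexTuples_eq_iUnion (n : ℕ) : vertexTuples n = ⋃ S, patternTuples n S := by
  classical
  ext x
  simp only [Set.mem_iUnion]
  constructor
  · intro hx
    exact ⟨Finset.univ.filter fun i => x i ∈ polygonVertices n, hx, fun i => by simp⟩
  · rintro ⟨S, hx, -⟩
    exact hx

lemma patternTuples_disjoint (n : ℕ) : Pairwise (Function.onFun Disjoint (patternTuples n)) := by
  intro S S' hne
  rw [Function.onFun, Set.disjoint_left]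
  rintro x ⟨-, h⟩ ⟨-, h'⟩
  exact hne (Finset.ext fun i => (h i).symm.trans (h' i))

/-- The number of elements of `vertexTuples` in terms of the three essentially different
patterns. -/
lemma vertexTuples_count (hn : 3 ≤ n) (h4 : (patternTuples n Finset.univ).Finite)
    (h3 : (patternTuples n {0, 1, 2}).Finite) (h2 : (patternTuples n {0, 1}).Finite) :
    (vertexTuples n).Finite ∧ (vertexTuples n).ncard = (patternTuples n Finset.univ).ncard +
      4 * (patternTuples n {0, 1, 2}).ncard + 4 * (patternTuples n {0, 1}).ncard := by
  -- The indicators single out the three cyclic classes of patterns, which have 1, 4 and 4 members.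
  have key (S : Finset (Fin 4)) : (patternTuples n S).Finite ∧ (patternTuples n S).ncard =
      (patternTuples n Finset.univ).ncard * (if S.card = 4 then 1 else 0) +
      (patternTuples n {0, 1, 2}).ncard * (if S.card = 3 then 1 else 0) +
      (patternTuples n {0, 1}).ncard * (if ∃ k, S = {k, k + 1} then 1 else 0) := by
    have himage {S' : Finset (Fin 4)} (hfin : (patternTuples n S').Finite)
        (h : ∃ k : Fin 4, ∀ i, i ∈ S ↔ i + k ∈ S') : (patternTuples n S).Finite ∧
        (patternTuples n S).ncard = (patternTuples n S').ncard := by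
      obtain ⟨k, hk⟩ := h
      rw [patternTuples_eq_image k hk]
      exact ⟨hfin.image _, Set.ncard_image_of_injective _ (tupleShift_injective k)⟩
    by_cases c4 : S.card = 4
    · obtain ⟨e1, e2⟩ := (by decide : ∀ S : Finset (Fin 4), S.card = 4 →
        S.card ≠ 3 ∧ ¬ ∃ k, S = {k, k + 1}) S c4
      obtain ⟨h, h'⟩ := himage h4 ((by decide : ∀ S : Finset (Fin 4), S.card = 4 →
        ∃ k : Fin 4, ∀ i, i ∈ S ↔ i + k ∈ Finset.univ) S c4)
      rw [if_pos c4, if_neg e1, if_neg e2, h']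
      exact ⟨h, by ring⟩
    by_cases c3 : S.card = 3
    · have e2 := (by decide : ∀ S : Finset (Fin 4), S.card = 3 → ¬ ∃ k, S = {k, k + 1}) S c3
      obtain ⟨h, h'⟩ := himage h3 ((by decide : ∀ S : Finset (Fin 4), S.card = 3 →
        ∃ k : Fin 4, ∀ i, i ∈ S ↔ i + k ∈ ({0, 1, 2} : Finset (Fin 4))) S c3)
      rw [if_neg c4, if_pos c3, if_neg e2, h']
      exact ⟨h, by ring⟩
    by_cases c2 : ∃ k, S = {k, k + 1}
    · obtain ⟨h, h'⟩ := himage h2 ((by decide : ∀ S : Finset (Fin 4), (∃ k, S = {k, k + 1}) →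
        ∃ k : Fin 4, ∀ i, i ∈ S ↔ i + k ∈ ({0, 1} : Finset (Fin 4))) S c2)
      rw [if_neg c4, if_neg c3, if_pos c2, h']
      exact ⟨h, by ring⟩
    · have h : patternTuples n S = ∅ := by
        by_contra hne
        rcases pattern_cases hn (Set.nonempty_iff_ne_empty.mpr hne) with h | h | h
        · exact c4 h
        · exact c3 h
        · exact c2 h
      rw [if_neg c4, if_neg c3, if_neg c2, h]
      exact ⟨Set.finite_empty, by simp⟩
  have n4 : ∑ S : Finset (Fin 4), (if S.card = 4 then 1 else 0) = 1 := by decide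
  have n3 : ∑ S : Finset (Fin 4), (if S.card = 3 then 1 else 0) = 4 := by decide
  have n2 : ∑ S : Finset (Fin 4), (if ∃ k, S = {k, k + 1} then 1 else 0) = 4 := by decide
  rw [vertexTuples_eq_iUnion]
  refine ⟨Set.finite_iUnion fun S => (key S).1, ?_⟩
  rw [Set.ncard_iUnion_of_finite (fun S => (key S).1) (patternTuples_disjoint n),
    finsum_eq_sum_of_fintype, Finset.sum_congr rfl fun S _ => (key S).2, Finset.sum_add_distrib,
    Finset.sum_add_distrib, ← Finset.mul_sum, ← Finset.mul_sum, ← Finset.mul_sum, n4, n3, n2]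
  ring

end patterns

end

/-! ### Counting each pattern -/

noncomputable section

open Complex

section count

variable {n : ℕ}

lemma exists_vertex_offset (hn : 3 ≤ n) (k : ℤ) {v : ℂ} (hv : v ∈ polygonVertices n) :
    ∃ δ : ℕ, δ < n ∧ v = cis n (2 * k + 2 * δ) := by
  obtain ⟨q, rfl⟩ := hv
  have hn' : (0 : ℤ) < n := by omega
  have h0 := Int.emod_nonneg (q - k) hn'.ne'
  have h1 := Int.emod_lt_of_pos (q - k) hn'
  have h2 := Int.emod_add_mul_ediv (q - k) n
  refine ⟨((q - k) % n).toNat, by omega, ?_⟩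
  rw [Int.toNat_of_nonneg h0, cis_eq_iff (by omega)]
  exact ⟨(q - k) / n, by linarith⟩

lemma vertex_offset_inj (hn : 3 ≤ n) {k : ℤ} {δ δ' : ℕ} (hδ : δ < n) (hδ' : δ' < n)
    (h : cis n (2 * k + 2 * δ) = cis n (2 * k + 2 * δ')) : δ = δ' := by
  rw [cis_eq_iff (by omega), show 2 * k + 2 * (δ : ℤ) - (2 * k + 2 * δ') = 2 * (δ - δ') by ring,
    mul_dvd_mul_iff_left two_ne_zero] at h
  have := Int.eq_zero_of_abs_lt_dvd h (by rw [abs_lt]; omega)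
  omega

lemma vertex_index_inj (hn : 3 ≤ n) {k k' : ℕ} (hk : k < n) (hk' : k' < n)
    (h : cis n (2 * k) = cis n (2 * k')) : k = k' :=
  vertex_offset_inj hn (k := 0) hk hk' (by simpa using h)

lemma add_mem_polygonVertices (k δ : ℤ) : cis n (2 * k + 2 * δ) ∈ polygonVertices n :=
  ⟨k + δ, by rw [mul_add]⟩

lemma ncard_of_eq_image {α β : Type*} {T : Set β} {F : Finset α} {g : α → β} (h : T = g '' F)
    (hg : Set.InjOn g F) : T.Finite ∧ T.ncard = F.card := by
  subst h
  exact ⟨F.finite_toSet.image g, by rw [hg.ncard_image, Set.ncard_coe_finset]⟩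

/-- Rectangles with all vertices among the vertices of the polygon. -/
lemma patternTuples_univ_odd (hn : 3 ≤ n) (hodd : Odd n) :
    patternTuples n Finset.univ = ∅ := by
  rw [Set.eq_empty_iff_forall_notMem]
  rintro x ⟨⟨-, hsum, -, hdet⟩, hS⟩
  obtain ⟨k, hk⟩ := (hS 1).mpr (Finset.mem_univ _)
  obtain ⟨p, hp, hxp⟩ := exists_vertex_offset hn k ((hS 0).mpr (Finset.mem_univ _))
  obtain ⟨q, hq, hxq⟩ := exists_vertex_offset hn k ((hS 2).mpr (Finset.mem_univ _))
  obtain ⟨h01, h12, h02⟩ := distinct_of_planeDet hsum hdet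
  have hp0 : p ≠ 0 := by rintro rfl; exact h01 (by rw [hxp, hk]; simp)
  have hq0 : q ≠ 0 := by rintro rfl; exact h12 (by rw [hxq, hk]; simp)
  have h3 := (hS 3).mpr (Finset.mem_univ _)
  rw [show x 3 = x 0 + x 2 - x 1 by rw [hsum]; ring, hxp, hxq, hk] at h3
  have := eq_of_fourth_vertex hn k (by omega) (by omega) (by omega) (by omega) h3
  have : Even (n : ℤ) := ⟨|(p : ℤ) - q|, by linarith⟩
  rw [Int.even_coe_nat] at this
  exact Nat.not_even_iff_odd.mpr hodd this

/-- A right angle at `x 1` makes `x 0` and `x 2` antipodal. So `x 1` and the offset of `x 0`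
determine the rectangle, the offsets `0` and `m` being degenerate. -/
lemma patternTuples_univ_even (hn : 3 ≤ n) {m : ℕ} (hm : n = 2 * m) :
    (patternTuples n Finset.univ).Finite ∧
      (patternTuples n Finset.univ).ncard = n * (n - 2) := by
  have hneg (k : ℤ) : -cis n k = cis n (k + 2 * m) := by
    rw [← cis_add_self (by omega), hm]; push_cast; rfl
  have hcard : (Finset.range n ×ˢ (Finset.range n \ {0, m})).card = n * (n - 2) := by
    rw [Finset.card_product, Finset.card_sdiff_of_subset, Finset.card_range, Finset.card_pair]
    · omega
    · intro i hi
      simp only [Finset.mem_insert, Finset.mem_singleton] at hi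
      rw [Finset.mem_range]; omega
  rw [← hcard]
  refine ncard_of_eq_image (g := fun u : ℕ × ℕ => ![cis n (2 * u.1 + 2 * u.2), cis n (2 * u.1),
    -cis n (2 * u.1 + 2 * u.2), -cis n (2 * u.1)]) ?_ ?_
  · ext x
    constructor
    · rintro ⟨⟨-, hsum, -, hdet⟩, hS⟩
      obtain ⟨k, hkn, hk⟩ := exists_vertex_offset hn 0 ((hS 1).mpr (Finset.mem_univ _))
      rw [mul_zero, zero_add] at hk
      obtain ⟨p, hp, hxp⟩ := exists_vertex_offset hn k ((hS 0).mpr (Finset.mem_univ _))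
      obtain ⟨q, hq, hxq⟩ := exists_vertex_offset hn k ((hS 2).mpr (Finset.mem_univ _))
      obtain ⟨h01, h12, h02⟩ := distinct_of_planeDet hsum hdet
      have hp0 : p ≠ 0 := by rintro rfl; exact h01 (by rw [hxp, hk]; simp)
      have hq0 : q ≠ 0 := by rintro rfl; exact h12 (by rw [hxq, hk]; simp)
      have h3 := (hS 3).mpr (Finset.mem_univ _)
      rw [show x 3 = x 0 + x 2 - x 1 by rw [hsum]; ring, hxp, hxq, hk] at h3
      have hpq := eq_of_fourth_vertex hn k (by omega) (by omega) (by omega) (by omega) h3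
      have hx2 : x 2 = -x 0 := by
        rw [hxp, hxq, hneg, cis_eq_iff (by omega)]
        rcases abs_choice ((p : ℤ) - q) with h | h <;> rw [h] at hpq
        · exact ⟨-1, by linarith⟩
        · exact ⟨0, by linarith⟩
      have hx3 : x 3 = -x 1 := by
        rw [hx2, add_neg_cancel] at hsum
        exact eq_neg_of_add_eq_zero_right hsum.symm
      refine ⟨(k, p), ?_, ?_⟩
      · simp only [Finset.coe_product, Set.mem_prod, Finset.mem_coe, Finset.mem_range,
          Finset.mem_sdiff, Finset.mem_insert, Finset.mem_singleton]
        refine ⟨hkn, hp, ?_⟩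
        rintro (rfl | rfl)
        · exact hp0 rfl
        · rcases abs_choice ((p : ℤ) - q) with h | h <;> rw [h] at hpq <;> omega
      · funext i
        fin_cases i
        · exact hxp.symm
        · exact hk.symm
        · simp [hx2, hxp]
        · simp [hx3, hk]
    · rintro ⟨⟨k, p⟩, hu, rfl⟩
      simp only [Finset.coe_product, Set.mem_prod, Finset.mem_coe, Finset.mem_range,
          Finset.mem_sdiff, Finset.mem_insert, Finset.mem_singleton, not_or] at hu
      obtain ⟨hk, hp, hp0, hpm⟩ := hu
      have hV : ∀ i, (![cis n (2 * k + 2 * p), cis n (2 * k), -cis n (2 * k + 2 * p),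
          -cis n (2 * k)] : Fin 4 → ℂ) i ∈ polygonVertices n := by
        intro i
        fin_cases i
        · exact add_mem_polygonVertices _ _
        · exact ⟨k, rfl⟩
        · refine ⟨k + p + m, ?_⟩
          simp only [Fin.reduceFinMk, Matrix.cons_val]
          rw [hneg]; congr 1; ring
        · refine ⟨k + m, ?_⟩
          simp only [Fin.reduceFinMk, Matrix.cons_val]
          rw [hneg]; congr 1; ring
      refine ⟨⟨fun i => polygonVertices_subset hn (hV i), by simp, Or.inl ⟨0, fun i _ => hV i⟩, ?_⟩,
        fun i => by simp [hV i]⟩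
      rw [planeDet_diagonals (by simp)]
      refine mul_ne_zero two_ne_zero (planeDet_ne_zero_of_circle (normSq_vertex (hV 0))
        (normSq_vertex (hV 1)) (normSq_vertex (hV 2)) ?_ ?_ ?_)
      · simp only [Matrix.cons_val]
        intro h
        exact hp0 (vertex_offset_inj hn (k := k) hp (by omega) (by simpa using h))
      · simp only [Matrix.cons_val]
        intro h
        apply hpm
        refine vertex_offset_inj hn (k := k) hp (by omega) ?_
        rw [← neg_eq_iff_eq_neg, hneg] at h
        exact h.symm
      · simp only [Matrix.cons_val]
        intro h
        have h1 := normSq_vertex (hV 0)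
        have h0 := self_eq_neg.mp h
        simp only [Matrix.cons_val] at h1
        rw [h0] at h1
        norm_num at h1
  · rintro ⟨k, p⟩ hu ⟨k', p'⟩ hu' h
    simp only [Finset.coe_product, Set.mem_prod, Finset.mem_coe, Finset.mem_range,
          Finset.mem_sdiff] at hu hu'
    have h0 := congrFun h 0
    have h1 := congrFun h 1
    simp only [Matrix.cons_val] at h0 h1
    obtain rfl := vertex_index_inj hn hu.1 hu'.1 h1
    obtain rfl := vertex_offset_inj hn hu.2.1 hu'.2.1 h0
    rfl

/-- The index pairs of the parallelograms that have exactly three vertices among the vertices of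
the polygon, one of them being fixed. -/
def obtusePairs (n : ℕ) : Finset (ℕ × ℕ) :=
  (Finset.range n ×ˢ Finset.range n).filter fun u =>
    0 < u.1 ∧ 0 < u.2 ∧ (n + 2 * u.2 < 2 * u.1 ∨ n + 2 * u.1 < 2 * u.2)

lemma mem_obtusePairs {p q : ℕ} : (p, q) ∈ obtusePairs n ↔
    0 < p ∧ p < n ∧ 0 < q ∧ q < n ∧ (n : ℤ) < 2 * |(p : ℤ) - q| := by
  simp only [obtusePairs, Finset.mem_filter, Finset.mem_product, Finset.mem_range]
  have : (n + 2 * q < 2 * p ∨ n + 2 * p < 2 * q) ↔ (n : ℤ) < 2 * |(p : ℤ) - q| := by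
    rcases le_total q p with h | h
    · rw [abs_of_nonneg (by omega)]; omega
    · rw [abs_of_nonpos (by omega)]; omega
  rw [this]
  tauto

lemma card_obtusePairs (n : ℕ) :
    (obtusePairs n).card = (n - 1 - n / 2) * (n - 1 - n / 2 - 1) := by
  set M := n - 1 - n / 2 with hM
  -- The larger offset is `i + n / 2 + 1` and the smaller is `j + 1` with `j < i < M`; this form
  -- covers both parities.
  have hsplit : obtusePairs n =
      ((Finset.range M).sigma fun i => Finset.range i).image
        (fun u => (u.1 + n / 2 + 1, u.2 + 1)) ∪
      ((Finset.range M).sigma fun i => Finset.range i).image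
        (fun u => (u.2 + 1, u.1 + n / 2 + 1)) := by
    ext ⟨p, q⟩
    simp only [obtusePairs, Finset.mem_filter, Finset.mem_product, Finset.mem_range,
      Finset.mem_union, Finset.mem_image, Finset.mem_sigma, Sigma.exists, Prod.mk.injEq]
    constructor
    · rintro ⟨⟨h1, h2⟩, h3, h4, h5 | h5⟩
      · exact Or.inl ⟨p - n / 2 - 1, q - 1, by omega, by omega, by omega⟩
      · exact Or.inr ⟨q - n / 2 - 1, p - 1, by omega, by omega, by omega⟩
    · rintro (⟨i, j, h⟩ | ⟨i, j, h⟩) <;> omega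
  have hdisj : Disjoint (((Finset.range M).sigma fun i => Finset.range i).image
        (fun u => (u.1 + n / 2 + 1, u.2 + 1)))
      (((Finset.range M).sigma fun i => Finset.range i).image
        (fun u => (u.2 + 1, u.1 + n / 2 + 1))) := by
    rw [Finset.disjoint_left]
    rintro ⟨p, q⟩ h h'
    simp only [Finset.mem_range, Finset.mem_image, Finset.mem_sigma, Sigma.exists,
      Prod.mk.injEq] at h h'
    obtain ⟨i, j, h⟩ := h
    obtain ⟨i', j', h'⟩ := h'
    omega
  rw [hsplit, Finset.card_union_of_disjoint hdisj, Finset.card_image_of_injective,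
    Finset.card_image_of_injective, Finset.card_sigma, ← Finset.sum_range_id_mul_two]
  · simp only [Finset.card_range]; ring
  · rintro ⟨i, j⟩ ⟨i', j'⟩ h
    simp only [Prod.mk.injEq] at h
    obtain rfl : i = i' := by omega
    obtain rfl : j = j' := by omega
    rfl
  · rintro ⟨i, j⟩ ⟨i', j'⟩ h
    simp only [Prod.mk.injEq] at h
    obtain rfl : i = i' := by omega
    obtain rfl : j = j' := by omega
    rfl

lemma patternTuples_three (hn : 3 ≤ n) :
    (patternTuples n {0, 1, 2}).Finite ∧ (patternTuples n {0, 1, 2}).ncard =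
      n * ((n - 1 - n / 2) * (n - 1 - n / 2 - 1)) := by
  have hcard : (Finset.range n ×ˢ obtusePairs n).card =
      n * ((n - 1 - n / 2) * (n - 1 - n / 2 - 1)) := by
    rw [Finset.card_product, Finset.card_range, card_obtusePairs]
  rw [← hcard]
  refine ncard_of_eq_image (g := fun u : ℕ × ℕ × ℕ => ![cis n (2 * u.1 + 2 * u.2.1),
    cis n (2 * u.1), cis n (2 * u.1 + 2 * u.2.2),
    cis n (2 * u.1 + 2 * u.2.1) + cis n (2 * u.1 + 2 * u.2.2) - cis n (2 * u.1)]) ?_ ?_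
  · ext x
    constructor
    · rintro ⟨⟨hQ, hsum, -, hdet⟩, hS⟩
      obtain ⟨k, hkn, hk⟩ := exists_vertex_offset hn 0 ((hS 1).mpr (by decide))
      rw [mul_zero, zero_add] at hk
      obtain ⟨p, hp, hxp⟩ := exists_vertex_offset hn k ((hS 0).mpr (by decide))
      obtain ⟨q, hq, hxq⟩ := exists_vertex_offset hn k ((hS 2).mpr (by decide))
      obtain ⟨h01, h12, h02⟩ := distinct_of_planeDet hsum hdet
      have hp0 : p ≠ 0 := by rintro rfl; exact h01 (by rw [hxp, hk]; simp)
      have hq0 : q ≠ 0 := by rintro rfl; exact h12 (by rw [hxq, hk]; simp)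
      have hx3 : x 3 = x 0 + x 2 - x 1 := by rw [hsum]; ring
      have h3 := hQ 3
      rw [hx3, hxp, hxq, hk] at h3
      have hle := le_of_fourth_mem hn k (by omega) (by omega) (by omega) (by omega) h3
      -- A right angle at `x 1` would complete to a rectangle, making `x 3` a vertex.
      have hne : (n : ℤ) ≠ 2 * |(p : ℤ) - q| := by
        intro hpq
        have h4 : x 3 ∉ polygonVertices n := fun h => absurd ((hS 3).mp h) (by decide)
        apply h4
        have hx2 : x 2 = -x 0 := by
          rw [hxp, hxq, ← cis_add_self (by omega), cis_eq_iff (by omega)]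
          rcases abs_choice ((p : ℤ) - q) with h | h <;> rw [h] at hpq
          · exact ⟨-1, by linarith⟩
          · exact ⟨0, by linarith⟩
        refine ⟨k + |(p : ℤ) - q|, ?_⟩
        rw [hx3, hx2, hk, mul_add, ← hpq, cis_add_self (by omega)]
        ring
      refine ⟨(k, p, q), ?_, ?_⟩
      · rw [Finset.mem_coe, Finset.mem_product, mem_obtusePairs, Finset.mem_range]
        exact ⟨hkn, by omega, hp, by omega, hq, lt_of_le_of_ne hle hne⟩
      · funext i
        fin_cases i
        · exact hxp.symm
        · exact hk.symm
        · exact hxq.symm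
        · simp [hx3, hxp, hxq, hk]
    · rintro ⟨⟨k, p, q⟩, hu, rfl⟩
      rw [Finset.mem_coe, Finset.mem_product, mem_obtusePairs, Finset.mem_range] at hu
      obtain ⟨hk, hp0, hp, hq0, hq, hpq⟩ := hu
      have h3 := fourth_mem hn k (p := p) (q := q) (by omega) (by omega) (by omega) (by omega)
        hpq.le
      have h3' := normSq_fourth_lt_one hn k (p := p) (q := q) (by omega) (by omega) (by omega)
        (by omega) hpq
      have v0 := add_mem_polygonVertices (n := n) k p
      have v1 : cis n (2 * (k : ℤ)) ∈ polygonVertices n := ⟨k, rfl⟩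
      have v2 := add_mem_polygonVertices (n := n) k q
      have v3 : cis n (2 * k + 2 * p) + cis n (2 * k + 2 * q) - cis n (2 * k) ∉
        polygonVertices n := fun h => absurd (normSq_vertex h) h3'.ne
      have hsum : cis n (2 * k + 2 * p) + cis n (2 * k + 2 * q) = cis n (2 * k) +
        (cis n (2 * k + 2 * p) + cis n (2 * k + 2 * q) - cis n (2 * k)) := by ring
      refine ⟨⟨?_, hsum, Or.inl ⟨3, ?_⟩, ?_⟩, ?_⟩
      · intro i
        fin_cases i
        · exact polygonVertices_subset hn v0
        · exact polygonVertices_subset hn v1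
        · exact polygonVertices_subset hn v2
        · exact h3
      · intro i hi
        fin_cases i
        · exact v0
        · exact v1
        · exact v2
        · exact absurd rfl hi
      · simp only [Matrix.cons_val]
        rw [planeDet_diagonals hsum]
        refine mul_ne_zero two_ne_zero (planeDet_ne_zero_of_circle (normSq_vertex v0)
          (normSq_vertex v1) (normSq_vertex v2) ?_ ?_ ?_)
        · intro h
          have := vertex_offset_inj hn (k := k) (δ := p) (δ' := 0) hp (by omega) (by simpa using h)
          omega
        · intro h
          have := vertex_offset_inj hn (k := k) (δ := 0) (δ' := q) (by omega) hq (by simpa using h)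
          omega
        · intro h
          have := vertex_offset_inj hn (k := k) hp hq h
          subst this
          simp at hpq
          omega
      · intro i
        fin_cases i
        · exact iff_of_true v0 (by decide)
        · exact iff_of_true v1 (by decide)
        · exact iff_of_true v2 (by decide)
        · exact iff_of_false v3 (by decide)
  · rintro ⟨k, p, q⟩ hu ⟨k', p', q'⟩ hu' h
    rw [Finset.mem_coe, Finset.mem_product, mem_obtusePairs, Finset.mem_range] at hu hu'
    have h0 := congrFun h 0
    have h1 := congrFun h 1
    have h2 := congrFun h 2
    simp only [Matrix.cons_val] at h0 h1 h2
    obtain rfl := vertex_index_inj hn hu.1 hu'.1 h1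
    obtain rfl := vertex_offset_inj hn hu.2.2.1 hu'.2.2.1 h0
    obtain rfl := vertex_offset_inj hn hu.2.2.2.2.1 hu'.2.2.2.2.1 h2
    rfl

/-- An element of `patternTuples n {0, 1}` has its other two entries on non-parallel edges. -/
lemma openEdges_of_pattern_two (hn : 3 ≤ n) {x : Fin 4 → ℂ} (hx : x ∈ patternTuples n {0, 1}) :
    ∃ s t, OpenEdge n s (x 2) ∧ OpenEdge n t (x 3) ∧ ¬ (n : ℤ) ∣ 2 * (s - t) := by
  obtain ⟨⟨-, -, hr, -⟩, hS⟩ := hx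
  have n2 : x 2 ∉ polygonVertices n := fun h => absurd ((hS 2).mp h) (by decide)
  have n3 : x 3 ∉ polygonVertices n := fun h => absurd ((hS 3).mp h) (by decide)
  rcases hr with ⟨p, hp⟩ | ⟨p, q, s, t, hpq, hs, ht, hst, hv⟩
  · exfalso
    by_cases h : (2 : Fin 4) = p
    · exact n3 (hp 3 (by rw [← h]; decide))
    · exact n2 (hp 2 h)
  · have hp : p ∉ ({0, 1} : Finset (Fin 4)) := fun h => hs.notMem hn ((hS p).mpr h)
    have hq : q ∉ ({0, 1} : Finset (Fin 4)) := fun h => ht.notMem hn ((hS q).mpr h)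
    have key : ∀ p q : Fin 4, p ≠ q → p ∉ ({0, 1} : Finset (Fin 4)) →
        q ∉ ({0, 1} : Finset (Fin 4)) → (p = 2 ∧ q = 3) ∨ (p = 3 ∧ q = 2) := by decide
    rcases key p q hpq hp hq with ⟨rfl, rfl⟩ | ⟨rfl, rfl⟩
    · exact ⟨s, t, hs, ht, hst⟩
    · refine ⟨t, s, ht, hs, fun h => hst ?_⟩
      rw [show 2 * (s - t) = -(2 * (t - s)) by ring]
      exact h.neg_right

lemma not_dvd_of_offset {p : ℕ} (hp : p < n) {j : ℕ} (hj : j < n) (h : p ≠ j) :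
    ¬ (n : ℤ) ∣ (p : ℤ) - j := by
  intro hd
  have := Int.eq_zero_of_abs_lt_dvd hd (by rw [abs_lt]; omega)
  omega

lemma patternTuples_two_even (hn : 3 ≤ n) (heven : Even n) : patternTuples n {0, 1} = ∅ := by
  rw [Set.eq_empty_iff_forall_notMem]
  intro x hx
  obtain ⟨s, t, hs, ht, hst⟩ := openEdges_of_pattern_two hn hx
  obtain ⟨⟨-, hsum, -, hdet⟩, hS⟩ := hx
  obtain ⟨q, hq⟩ := (hS 1).mpr (by decide)
  obtain ⟨p, hp, hxp⟩ := exists_vertex_offset hn q ((hS 0).mpr (by decide))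
  obtain ⟨h01, -, -⟩ := distinct_of_planeDet hsum hdet
  have hp0 : p ≠ 0 := by rintro rfl; exact h01 (by rw [hxp, hq]; simp)
  rw [hxp, hq, ← mul_add] at hsum
  refine adjacent_even_false hn heven ?_ hs ht hst hsum
  have := not_dvd_of_offset hp (j := 0) (by omega) hp0
  simpa using this

/-- The side from `x 1` to `x 0` determines the rest. Its offset avoids `0`, where the side
collapses, and `m`, `m + 1`, where `x 0` is an end of the edge opposite `x 1`. -/
lemma patternTuples_two_odd (hn : 3 ≤ n) {m : ℕ} (hm : n = 2 * m + 1) :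
    (patternTuples n {0, 1}).Finite ∧ (patternTuples n {0, 1}).ncard = n * (n - 3) := by
  have hcard : (Finset.range n ×ˢ (Finset.range n \ {0, m, m + 1})).card = n * (n - 3) := by
    rw [Finset.card_product, Finset.card_sdiff_of_subset, Finset.card_range,
      Finset.card_eq_three.mpr ⟨0, m, m + 1, by omega, by omega, by omega, rfl⟩]
    intro i hi
    simp only [Finset.mem_insert, Finset.mem_singleton] at hi
    rw [Finset.mem_range]; omega
  rw [← hcard]
  have hcond {k : ℤ} {p : ℕ} (hp : p < n) (h0 : p ≠ 0) (h1 : p ≠ m) (h2 : p ≠ m + 1) :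
      ¬ (n : ℤ) ∣ k + p - k ∧ ¬ (n : ℤ) ∣ k + p - (k + m) ∧ ¬ (n : ℤ) ∣ k + p - (k + m) - 1 := by
    have d0 := not_dvd_of_offset hp (j := 0) (by omega) h0
    have d1 := not_dvd_of_offset hp (j := m) (by omega) h1
    have d2 := not_dvd_of_offset hp (j := m + 1) (by omega) h2
    refine ⟨?_, ?_, ?_⟩
    · convert d0 using 2; simp
    · convert d1 using 2; ring
    · convert d2 using 2; push_cast; ring
  refine ncard_of_eq_image (g := fun u : ℕ × ℕ => ![cis n (2 * (u.1 + u.2)), cis n (2 * u.1),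
    cis n (2 * u.1) + chordShift n (u.1 + u.2) u.1 • cis n (u.1 + u.2 + u.1),
    chordEnd n (u.1 + u.2) u.1]) ?_ ?_
  · ext x
    constructor
    · intro hx
      obtain ⟨s, t, hs, ht, hst⟩ := openEdges_of_pattern_two hn hx
      obtain ⟨⟨-, hsum, -, hdet⟩, hS⟩ := hx
      obtain ⟨k, hkn, hk⟩ := exists_vertex_offset hn 0 ((hS 1).mpr (by decide))
      rw [mul_zero, zero_add] at hk
      obtain ⟨p, hp, hxp⟩ := exists_vertex_offset hn k ((hS 0).mpr (by decide))
      obtain ⟨h01, -, -⟩ := distinct_of_planeDet hsum hdet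
      have hp0 : p ≠ 0 := by rintro rfl; exact h01 (by rw [hxp, hk]; simp)
      rw [← mul_add] at hxp
      have hsum' := hsum
      rw [hxp, hk] at hsum'
      have hd0 : ¬ (n : ℤ) ∣ k + p - k := by
        have := not_dvd_of_offset hp (j := 0) (by omega) hp0
        simpa using this
      obtain ⟨hd, h1, h2⟩ := adjacent_odd hn hm hd0 hs ht hst hsum'
      refine ⟨(k, p), ?_, ?_⟩
      · simp only [Finset.coe_product, Set.mem_prod, Finset.mem_coe, Finset.mem_range,
          Finset.mem_sdiff, Finset.mem_insert, Finset.mem_singleton, not_or]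
        refine ⟨hkn, hp, hp0, ?_, ?_⟩
        · rintro rfl; exact h1 (by simp)
        · rintro rfl; exact h2 (by simp)
      · funext i
        fin_cases i
        · exact hxp.symm
        · exact hk.symm
        · simp only [Fin.reduceFinMk, Matrix.cons_val]
          rw [chordEnd] at hd
          rw [hd] at hsum'
          linear_combination -hsum'
        · exact hd.symm
    · rintro ⟨⟨k, p⟩, hu, rfl⟩
      simp only [Finset.coe_product, Set.mem_prod, Finset.mem_coe, Finset.mem_range,
          Finset.mem_sdiff, Finset.mem_insert, Finset.mem_singleton, not_or] at hu
      obtain ⟨hk, hp, hp0, hpm, hpm'⟩ := hu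
      obtain ⟨d0, d1, d2⟩ := hcond (k := k) hp hp0 hpm hpm'
      have h3 := chordEnd_openEdge hn hm d0 d1 d2
      have h2 := chordEnd_symm_openEdge hn hm d0 d1 d2
      have v0 : cis n (2 * ((k : ℤ) + p)) ∈ polygonVertices n := ⟨k + p, rfl⟩
      have v1 : cis n (2 * (k : ℤ)) ∈ polygonVertices n := ⟨k, rfl⟩
      refine ⟨⟨?_, ?_, Or.inr ⟨2, 3, _, _, by decide, h2, h3, ?_, ?_⟩, ?_⟩, ?_⟩
      · intro i
        fin_cases i
        · exact polygonVertices_subset hn v0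
        · exact polygonVertices_subset hn v1
        · exact h2.mem hn
        · exact h3.mem hn
      · simp only [Matrix.cons_val, chordEnd]
        ring
      · rintro ⟨l, hl⟩
        have hn' : (n : ℤ) = 2 * m + 1 := by exact_mod_cast hm
        -- The edge indices are `k + p - m - 1` and `k + m`; twice their difference is `2 * p - 2 *
        -- n`.
        have h : (n : ℤ) ∣ 2 * ((k : ℤ) + p - k) := ⟨l + 2, by linear_combination hl - 2 * hn'⟩
        exact d0 ((isCoprime_two_of_odd ⟨m, hm⟩).dvd_of_dvd_mul_left h)
      · intro i hi hi'
        fin_cases i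
        · exact v0
        · exact v1
        · exact absurd rfl hi
        · exact absurd rfl hi'
      · simp only [Matrix.cons_val]
        exact planeDet_chord_ne_zero hn d0 (h3.notMem hn)
      · intro i
        fin_cases i
        · exact iff_of_true v0 (by decide)
        · exact iff_of_true v1 (by decide)
        · exact iff_of_false (h2.notMem hn) (by decide)
        · exact iff_of_false (h3.notMem hn) (by decide)
  · rintro ⟨k, p⟩ hu ⟨k', p'⟩ hu' h
    simp only [Finset.coe_product, Set.mem_prod, Finset.mem_coe, Finset.mem_range,
          Finset.mem_sdiff] at hu hu'
    have h0 := congrFun h 0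
    have h1 := congrFun h 1
    simp only [Matrix.cons_val] at h0 h1
    obtain rfl := vertex_index_inj hn hu.1 hu'.1 h1
    rw [mul_add, mul_add] at h0
    obtain rfl := vertex_offset_inj hn hu.2.1 hu'.2.1 h0
    rfl

end count

end

/-! ### Summing the counts -/

theorem mainTheorem7 (n : ℕ) (hn : 3 ≤ n) :
    (verticesOfRank (regularPolygon 4) (regularPolygon n) 2).Finite ∧
    (Odd n →
      ((verticesOfRank (regularPolygon 4) (regularPolygon n) 2).ncard : ℤ)
        = (n : ℤ) ^ 3 - 9 * (n : ℤ)) ∧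
    (Even n →
      ((verticesOfRank (regularPolygon 4) (regularPolygon n) 2).ncard : ℤ)
        = (n : ℤ) ^ 3 - 5 * (n : ℤ) ^ 2 + 6 * (n : ℤ)) := by
  have himage := image_squareTuple hn
  have hfin (h : (vertexTuples n).Finite) :
      (verticesOfRank (regularPolygon 4) (regularPolygon n) 2).Finite :=
    Set.Finite.of_finite_image (himage ▸ h) squareTuple_injective.injOn
  have hncard : (verticesOfRank (regularPolygon 4) (regularPolygon n) 2).ncard =
      (vertexTuples n).ncard := by
    rw [← himage, Set.ncard_image_of_injective _ squareTuple_injective]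
  obtain ⟨f3, c3⟩ := patternTuples_three hn
  rcases Nat.even_or_odd' n with ⟨m, hm | hm⟩
  · obtain ⟨f4, c4⟩ := patternTuples_univ_even hn hm
    have e2 := patternTuples_two_even hn ⟨m, by omega⟩
    obtain ⟨h, hc⟩ := vertexTuples_count hn f4 f3 (by rw [e2]; exact Set.finite_empty)
    refine ⟨hfin h, fun ho => absurd ho (by rw [Nat.not_odd_iff_even]; exact ⟨m, by omega⟩),
      fun _ => ?_⟩
    -- Here `m ≥ 2`, and the substitution removes the truncated subtractions.
    obtain ⟨l, rfl⟩ : ∃ l, m = l + 2 := ⟨m - 2, by omega⟩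
    rw [hncard, hc, c4, c3, e2, Set.ncard_empty, show n - 1 - n / 2 = l + 1 by omega,
      show l + 1 - 1 = l by omega, show n - 2 = 2 * l + 2 by omega, hm]
    push_cast
    ring
  · have e4 := patternTuples_univ_odd hn ⟨m, hm⟩
    obtain ⟨f2, c2⟩ := patternTuples_two_odd hn hm
    obtain ⟨h, hc⟩ := vertexTuples_count hn (by rw [e4]; exact Set.finite_empty) f3 f2
    refine ⟨hfin h, fun _ => ?_, fun he => absurd he (by
      rw [Nat.not_even_iff_odd]; exact ⟨m, hm⟩)⟩
    obtain ⟨l, rfl⟩ : ∃ l, m = l + 1 := ⟨m - 1, by omega⟩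
    rw [hncard, hc, e4, Set.ncard_empty, c3, c2, show n - 1 - n / 2 = l + 1 by omega,
      show l + 1 - 1 = l by omega, show n - 3 = 2 * l by omega, hm]
    push_cast
    ring
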